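/- **Setting.** In the Line Traveling Salesman Problem with collaboration (CLTSP), a server starts at time $0$ at the origin of the real line and moves with speed at most $1$. There are $n\ge 1$ clients; client $a$ has a starting position $s(a)\in\mathbb R$, a release date $r(a)\ge 0$, a deadline $d(a)\in[0,\infty]$ and a processing time $\tau(a)\ge 0$, and all clients move along the line with speed at most $v$. A solution consists of a rendezvous time $t(a)\ge 0$ and position $x(a)$ for each client $a$ and an end time $t_{n+1}$. It is feasible if $r(a)+|x(a)-s(a)|/v\le t(a)$ and $r(a)\le t(a)\le d(a)$ for all $a$, and if the clients can be ordered as $\sigma_1,\dots,\sigma_n$ such that, with $t_i=t(\sigma_i)$, $x_i=x(\sigma_i)$, $c_i=t_i+\tau(\sigma_i)$ for $1\le i\le n$, $c_0=0$ and $x_0=x_{n+1}=0$, one has $c_{i-1}+|x_i-x_{i-1}|\le t_i$ for $1\le i\le n+1$. Its makespan is $t_{n+1}$. A feasible solution of minimum makespan is optimal. **Algorithm.** Let $\ell(1),\dots,\ell(n_L)$ be the clients with $s(a)\le 0$ and $\rho(1),\dots,\rho(n_R)$ those with $s(a)>0$, each in non-decreasing order of $|s(a)|$ (ties broken arbitrarily).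 If $n_L\ge 1$ and $|s(\ell(1))|/(1+v)>d(\ell(1))$, or $n_R\ge 1$ and $|s(\rho(1))|/(1+v)>d(\rho(1))$, return "infeasible". Otherwise compute a table $D(i,j,\delta)\in[0,\infty]$ for $0\le i\le n_L$, $0\le j\le n_R$, $\delta\in\{L,R\}$, in lexicographic order. Put $D(1,0,L)=|s(\ell(1))|/(1+v)$ if $n_L\ge 1$, $D(0,1,R)=|s(\rho(1))|/(1+v)$ if $n_R\ge 1$, and $D(0,j,L)=D(i,0,R)=\infty$. For all other states $S=(i,j,\delta)$ put $$D(S)=\min_{S'}\bigl(D(S')+T(S',S)\bigr),$$ where $S'$ ranges over $(i-1,j,L),(i-1,j,R)$ if $\delta=L$ and over $(i,j-1,L),(i,j-1,R)$ if $\delta=R$. Here the client of a state $(i,j,L)$ is $\ell(i)$ and that of $(i,j,R)$ is $\rho(j)$; for a state $Q$ with client $a$ let $X_Q(y)=s(a)+vy$ if $a$ is of the first kind and $X_Q(y)=s(a)-vy$ if it is of the second kind. If $y=D(S')<\infty$, $w=|X_{S'}(y)-X_S(y)|/(1+v)$ and $y+w\le d(a)$ for the client $a$ of $S$, then $T(S',S)=w$;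 otherwise $T(S',S)=\infty$. Finally, with $S_L=(n_L,n_R,L)$ and $S_R=(n_L,n_R,R)$, return $$\min_{S\in\{S_L,S_R\}}\bigl(D(S)+|X_S(D(S))|\bigr),$$ where a term with $D(S)=\infty$ is $\infty$, and the value $\infty$ means "infeasible". If the value is finite, the rendezvous $(t(a),x(a))=(D(S),X_S(D(S)))$ are read off from the states $S$ on a minimizing path, where $a$ is the client of $S$. **Theorem.** Suppose that all processing times are zero, that there are only deadlines ($r(a)=0$ for all $a$), and that the clients are slow ($0<v<1$). Then this algorithm solves the CLTSP in $O(n^2)$ time: if there is no feasible solution, it returns "infeasible"; otherwise an optimal solution exists, and the algorithm returns the minimum makespan together with an optimal solution. Its implementation, including the sorting of the clients, takes at most $Cn^2$ steps for an absolute constant $C$ on a random access machine that performs arithmetic and comparisons of elements of $\mathbb R\cup\{\infty\}$ and memory accesses at unit cost. -/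

import Mathlib

set_option linter.constructorNameAsVariable false

/-! ## A real random access machine

Programs are written in a small imperative language over registers and arrays. Words are elements
of an ordered field `K` or the symbol `∞` (written `⊤`); indices are natural numbers. Every
expression node, comparison, store, branch and loop iteration costs one step. There is no
instruction that hides more than one arithmetic operation or one memory access. -/

namespace RealRAM

/-- Arithmetic on `K ∪ {∞}` is strict: the result is `∞` as soon as one operand is `∞`. -/
def lift₁ {K : Type} (f : K → K) : WithTop K → WithTop K
  | ⊤ => ⊤
  | (a : K) => ((f a : K) : WithTop K)

/-- Arithmetic on `K ∪ {∞}` is strict: the result is `∞` as soon as one operand is `∞`. -/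
def lift₂ {K : Type} (f : K → K → K) : WithTop K → WithTop K → WithTop K
  | (a : K), (b : K) => ((f a b : K) : WithTop K)
  | _, _ => ⊤

/-- Names of the registers that hold natural numbers. -/
inductive NReg
  | n | nL | nR | a | b | k | i | j | side | ok
  deriving DecidableEq

/-- Names of the (two-dimensional) arrays of natural numbers. -/
inductive NArr
  | lft | rgt | predL | predR
  deriving DecidableEq

/-- Names of the registers that hold words. -/
inductive WReg
  | v | y | gap | c₁ | c₂ | out
  deriving DecidableEq

/-- Names of the (two-dimensional) arrays of words. -/
inductive WArr
  | s | d | DL | DR | t | x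
  deriving DecidableEq

/-- The memory of the machine. One-dimensional arrays use the second index `0`. -/
structure Mem (K : Type) where
  nreg : NReg → ℕ
  narr : NArr → ℕ → ℕ → ℕ
  wreg : WReg → WithTop K
  warr : WArr → ℕ → ℕ → WithTop K

namespace Mem

variable {K : Type}

def setN (m : Mem K) (x : NReg) (z : ℕ) : Mem K :=
  { m with nreg := fun x' => if x' = x then z else m.nreg x' }

def setNArr (m : Mem K) (x : NArr) (p q : ℕ) (z : ℕ) : Mem K :=
  { m with narr := fun x' p' q' => if x' = x ∧ p' = p ∧ q' = q then z else m.narr x' p' q' }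

def setW (m : Mem K) (x : WReg) (z : WithTop K) : Mem K :=
  { m with wreg := fun x' => if x' = x then z else m.wreg x' }

def setWArr (m : Mem K) (x : WArr) (p q : ℕ) (z : WithTop K) : Mem K :=
  { m with warr := fun x' p' q' => if x' = x ∧ p' = p ∧ q' = q then z else m.warr x' p' q' }

end Mem

/-- Expressions for natural numbers (`sub` is truncated subtraction). -/
inductive NExp
  | lit (z : ℕ)
  | reg (x : NReg)
  | get (x : NArr) (p q : NExp)
  | add (e f : NExp)
  | sub (e f : NExp)

/-- Expressions for words. -/
inductive WExp
  | zero
  | one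
  | inf
  | reg (x : WReg)
  | get (x : WArr) (p q : NExp)
  | add (e f : WExp)
  | sub (e f : WExp)
  | mul (e f : WExp)
  | div (e f : WExp)
  | abs (e : WExp)

/-- Boolean conditions: equality and order of natural numbers, order of words. -/
inductive BExp
  | natLt (e f : NExp)
  | natEq (e f : NExp)
  | wordLt (e f : WExp)
  | wordLe (e f : WExp)
  | not (b : BExp)
  | and (b c : BExp)
  | or (b c : BExp)

/-- Programs. `forLoop x lo hi c` executes `c` for `x = lo, lo + 1, …, hi - 1`; the bounds are
evaluated once, before the first iteration. -/
inductive Cmd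
  | skip
  | setN (x : NReg) (e : NExp)
  | setNArr (x : NArr) (p q : NExp) (e : NExp)
  | setW (x : WReg) (e : WExp)
  | setWArr (x : WArr) (p q : NExp) (e : WExp)
  | seq (c c' : Cmd)
  | ite (b : BExp) (c c' : Cmd)
  | forLoop (x : NReg) (lo hi : NExp) (c : Cmd)

/-! ### Values of expressions -/

section Semantics

variable {K : Type}

def NExp.eval (m : Mem K) : NExp → ℕ
  | .lit z => z
  | .reg x => m.nreg x
  | .get x p q => m.narr x (p.eval m) (q.eval m)
  | .add e f => e.eval m + f.eval m
  | .sub e f => e.eval m - f.eval m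

variable [Field K] [LinearOrder K]

def WExp.eval (m : Mem K) : WExp → WithTop K
  | .zero => ((0 : K) : WithTop K)
  | .one => ((1 : K) : WithTop K)
  | .inf => ⊤
  | .reg x => m.wreg x
  | .get x p q => m.warr x (p.eval m) (q.eval m)
  | .add e f => lift₂ (fun a b => a + b) (e.eval m) (f.eval m)
  | .sub e f => lift₂ (fun a b => a - b) (e.eval m) (f.eval m)
  | .mul e f => lift₂ (fun a b => a * b) (e.eval m) (f.eval m)
  | .div e f => lift₂ (fun a b => a / b) (e.eval m) (f.eval m)
  | .abs e => lift₁ (fun a => |a|) (e.eval m)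

def BExp.eval (m : Mem K) : BExp → Bool
  | .natLt e f => decide (e.eval m < f.eval m)
  | .natEq e f => decide (e.eval m = f.eval m)
  | .wordLt e f => decide (e.eval m < f.eval m)
  | .wordLe e f => decide (e.eval m ≤ f.eval m)
  | .not b => !(b.eval m)
  | .and b c => b.eval m && c.eval m
  | .or b c => b.eval m || c.eval m

/-! ### Execution -/

/-- `k` iterations of a loop with body `f`, with loop counter `x = lo, …, lo + k - 1`. -/
def iterate (f : Mem K → Mem K) (x : NReg) (lo : ℕ) : ℕ → Mem K → Mem K
  | 0, m => m
  | k + 1, m => f ((iterate f x lo k m).setN x (lo + k))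

/-- The memory after the execution of a program. -/
def Cmd.run : Cmd → Mem K → Mem K
  | .skip, m => m
  | .setN x e, m => m.setN x (e.eval m)
  | .setNArr x p q e, m => m.setNArr x (p.eval m) (q.eval m) (e.eval m)
  | .setW x e, m => m.setW x (e.eval m)
  | .setWArr x p q e, m => m.setWArr x (p.eval m) (q.eval m) (e.eval m)
  | .seq c c', m => c'.run (c.run m)
  | .ite b c c', m => if b.eval m then c.run m else c'.run m
  | .forLoop x lo hi c, m => iterate c.run x (lo.eval m) (hi.eval m - lo.eval m) m

end Semantics

/-! ### Number of steps -/

/-- One step for every literal, register read, array read and operation. -/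
def NExp.cost : NExp → ℕ
  | .lit _ => 1
  | .reg _ => 1
  | .get _ p q => p.cost + q.cost + 1
  | .add e f => e.cost + f.cost + 1
  | .sub e f => e.cost + f.cost + 1

/-- One step for every literal, register read, array read and operation. -/
def WExp.cost : WExp → ℕ
  | .zero => 1
  | .one => 1
  | .inf => 1
  | .reg _ => 1
  | .get _ p q => p.cost + q.cost + 1
  | .add e f => e.cost + f.cost + 1
  | .sub e f => e.cost + f.cost + 1
  | .mul e f => e.cost + f.cost + 1
  | .div e f => e.cost + f.cost + 1
  | .abs e => e.cost + 1

/-- One step for every comparison and connective, plus the operands. -/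
def BExp.cost : BExp → ℕ
  | .natLt e f => e.cost + f.cost + 1
  | .natEq e f => e.cost + f.cost + 1
  | .wordLt e f => e.cost + f.cost + 1
  | .wordLe e f => e.cost + f.cost + 1
  | .not b => b.cost + 1
  | .and b c => b.cost + c.cost + 1
  | .or b c => b.cost + c.cost + 1

section Steps

variable {K : Type} [Field K] [LinearOrder K]

/-- Total number of steps of `k` iterations of a loop whose body `f` takes `g m` steps when it is
started with memory `m`; every iteration costs one additional step. -/
def iterateSteps (f : Mem K → Mem K) (g : Mem K → ℕ) (x : NReg) (lo : ℕ) : ℕ → Mem K → ℕ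
  | 0, _ => 0
  | k + 1, m => iterateSteps f g x lo k m + (1 + g ((iterate f x lo k m).setN x (lo + k)))

/-- The number of steps that a program takes when it is started with memory `m`. -/
def Cmd.steps : Cmd → Mem K → ℕ
  | .skip, _ => 1
  | .setN _ e, _ => e.cost + 1
  | .setNArr _ p q e, _ => p.cost + q.cost + e.cost + 1
  | .setW _ e, _ => e.cost + 1
  | .setWArr _ p q e, _ => p.cost + q.cost + e.cost + 1
  | .seq c c', m => c.steps m + c'.steps (c.run m)
  | .ite b c c', m => b.cost + 1 + (if b.eval m then c.steps m else c'.steps m)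
  | .forLoop x lo hi c, m =>
      lo.cost + hi.cost + 1 +
        iterateSteps c.run c.steps x (lo.eval m) (hi.eval m - lo.eval m) m

end Steps

/-- Sequential composition of a list of programs. -/
def Cmd.block : List Cmd → Cmd
  | [] => .skip
  | [c] => c
  | c :: cs => .seq c (Cmd.block cs)

end RealRAM

/-! ## The Line Traveling Salesman Problem with collaboration -/

namespace CLTSP

/-- An instance with clients `0, …, n - 1`: the speed `v` of the clients and, for every client,
the initial position `s`, the release date `r`, the deadline `d` (possibly `∞`) and the
processing time `τ`. -/
structure Inst (n : ℕ) where
  v : ℝ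
  s : Fin n → ℝ
  r : Fin n → ℝ
  d : Fin n → WithTop ℝ
  τ : Fin n → ℝ
  v_nonneg : 0 ≤ v
  r_nonneg : ∀ a, 0 ≤ r a
  d_nonneg : ∀ a, 0 ≤ d a
  τ_nonneg : ∀ a, 0 ≤ τ a

/-- A solution: time `t a` and position `x a` of the rendezvous with every client `a`, and the time
`tEnd` at which the server ends its tour. -/
structure Solution (n : ℕ) where
  t : Fin n → ℝ
  x : Fin n → ℝ
  tEnd : ℝ

namespace Solution

variable {n : ℕ} (S : Solution n) (σ : Equiv.Perm (Fin n))

/-- The vector `(t₀, t₁, …, tₙ₊₁)` if the clients are served in the order `σ`. -/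
def time : ℕ → ℝ
  | 0 => 0
  | k + 1 => if h : k < n then S.t (σ ⟨k, h⟩) else S.tEnd

/-- The vector `(x₀, x₁, …, xₙ₊₁)` if the clients are served in the order `σ`; the server starts
and ends at the origin. -/
def position : ℕ → ℝ
  | 0 => 0
  | k + 1 => if h : k < n then S.x (σ ⟨k, h⟩) else 0

/-- The vector `(c₀, c₁, …, cₙ₊₁)` of completion times, for processing times `τ`. -/
def completion (τ : Fin n → ℝ) : ℕ → ℝ
  | 0 => 0
  | k + 1 => if h : k < n then S.t (σ ⟨k, h⟩) + τ (σ ⟨k, h⟩) else S.tEnd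

/-- The makespan `cₙ₊₁`. -/
def makespan : ℝ := S.tEnd

end Solution

namespace Inst

variable {n : ℕ} (I : Inst n)

/-- Slow clients. -/
def SlowClients : Prop := 0 < I.v ∧ I.v < 1

/-- Only deadlines, no release dates. -/
def DeadlinesOnly : Prop := ∀ a, I.r a = 0

/-- Zero processing times. -/
def ZeroProcessing : Prop := ∀ a, I.τ a = 0

/-- Feasibility of a solution in which the clients are served in the order `σ`. -/
structure FeasibleInOrder (S : Solution n) (σ : Equiv.Perm (Fin n)) : Prop where
  nonneg : ∀ a, 0 ≤ S.t a
  reachable_server : ∀ i, 1 ≤ i → i ≤ n + 1 →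
    S.completion σ I.τ (i - 1) + |S.position σ i - S.position σ (i - 1)| ≤ S.time σ i
  reachable_client : ∀ a, I.r a + |S.x a - I.s a| / I.v ≤ S.t a
  release : ∀ a, I.r a ≤ S.t a
  deadline : ∀ a, (S.t a : WithTop ℝ) ≤ I.d a

/-- A solution is feasible if it is feasible for some order of the clients. -/
def Feasible (S : Solution n) : Prop := ∃ σ, I.FeasibleInOrder S σ

/-- Optimal solutions: feasible solutions of minimum makespan. -/
def Optimal (S : Solution n) : Prop :=
  I.Feasible S ∧ ∀ S', I.Feasible S' → S.makespan ≤ S'.makespan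

end Inst

/-! ## The dynamic program as a system of equations -/

/-- The side of the origin on which a client starts. -/
inductive Side
  | L | R
  deriving DecidableEq

namespace Inst

variable {n : ℕ} (I : Inst n)

/-- The clients that start at a position `≤ 0`. -/
noncomputable def left : Finset (Fin n) := Finset.univ.filter fun a => I.s a ≤ 0

/-- The clients that start at a position `> 0`. -/
noncomputable def right : Finset (Fin n) := Finset.univ.filter fun a => 0 < I.s a

/-- `ℓ 1, …, ℓ n_L` are the clients on the left and `r 1, …, r n_R` the clients on the right, each
by non-decreasing distance from the origin. The other values of `ℓ` and `r` are immaterial. -/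
structure IsOrdering (ℓ r : ℕ → Fin n) : Prop where
  left_bij : Set.BijOn ℓ (Set.Icc 1 I.left.card) I.left
  right_bij : Set.BijOn r (Set.Icc 1 I.right.card) I.right
  left_mono : ∀ i j, 1 ≤ i → i ≤ j → j ≤ I.left.card → |I.s (ℓ i)| ≤ |I.s (ℓ j)|
  right_mono : ∀ i j, 1 ≤ i → i ≤ j → j ≤ I.right.card → |I.s (r i)| ≤ |I.s (r j)|

/-- The position at time `t` of a client of the given side that moves towards the origin (and
beyond it) at full speed. -/
def front (side : Side) (a : Fin n) (t : ℝ) : ℝ :=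
  match side with
  | .L => I.s a + I.v * t
  | .R => I.s a - I.v * t

/-- The transition time `T(S', S)`: in the state `S'` the server meets client `a'` of side `side'`
at time `D' = D(S')`, and in the state `S` it meets client `a` of side `side` next. -/
noncomputable def transition (side' : Side) (a' : Fin n) (side : Side) (a : Fin n) :
    WithTop ℝ → WithTop ℝ
  | ⊤ => ⊤
  | (D' : ℝ) =>
      if ((D' + |I.front side' a' D' - I.front side a D'| / (1 + I.v) : ℝ) : WithTop ℝ) ≤ I.d a
      then ((|I.front side' a' D' - I.front side a D'| / (1 + I.v) : ℝ) : WithTop ℝ)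
      else ⊤

/-- The dynamic programming table `D(i, j, side)`. The states `(0, j, L)` and `(i, 0, R)` cannot
be reached. -/
noncomputable def table (ℓ r : ℕ → Fin n) : ℕ → ℕ → Side → WithTop ℝ
  | 0, _, .L => ⊤
  | i + 1, j, .L =>
      if i = 0 ∧ j = 0 then ((|I.s (ℓ 1)| / (1 + I.v) : ℝ) : WithTop ℝ)
      else min
        (table ℓ r i j .L + I.transition .L (ℓ i) .L (ℓ (i + 1)) (table ℓ r i j .L))
        (table ℓ r i j .R + I.transition .R (r j) .L (ℓ (i + 1)) (table ℓ r i j .R))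
  | _, 0, .R => ⊤
  | i, j + 1, .R =>
      if i = 0 ∧ j = 0 then ((|I.s (r 1)| / (1 + I.v) : ℝ) : WithTop ℝ)
      else min
        (table ℓ r i j .L + I.transition .L (ℓ i) .R (r (j + 1)) (table ℓ r i j .L))
        (table ℓ r i j .R + I.transition .R (r j) .R (r (j + 1)) (table ℓ r i j .R))
  termination_by i j => i + j

/-- Time at which the server is back at the origin if it meets the last client `a`, of side `side`,
at the given time. -/
def returnTime (side : Side) (a : Fin n) : WithTop ℝ → WithTop ℝ
  | ⊤ => ⊤
  | (D : ℝ) => ((D + |I.front side a D| : ℝ) : WithTop ℝ)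

/-- If they are the first to be met, the first clients of both sides can be met in time. -/
def FirstInTime (ℓ r : ℕ → Fin n) : Prop :=
  (1 ≤ I.left.card → ((|I.s (ℓ 1)| / (1 + I.v) : ℝ) : WithTop ℝ) ≤ I.d (ℓ 1)) ∧
  (1 ≤ I.right.card → ((|I.s (r 1)| / (1 + I.v) : ℝ) : WithTop ℝ) ≤ I.d (r 1))

open Classical in
/-- The value that the dynamic program returns; `⊤` stands for the answer "infeasible". -/
noncomputable def dpValue (ℓ r : ℕ → Fin n) : WithTop ℝ :=
  if I.FirstInTime ℓ r then
    min (I.returnTime .L (ℓ I.left.card) (I.table ℓ r I.left.card I.right.card .L))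
      (I.returnTime .R (r I.right.card) (I.table ℓ r I.left.card I.right.card .R))
  else ⊤

end Inst

/-! ## The dynamic program as a program -/

open RealRAM

/-- The starting position of client `a`. -/
def sOf (a : NExp) : WExp := .get .s a (.lit 0)

/-- The deadline of client `a`. -/
def dOf (a : NExp) : WExp := .get .d a (.lit 0)

/-- The client that is stored as `ℓ i`. -/
def lftAt (i : NExp) : NExp := .get .lft i (.lit 0)

/-- The client that is stored as `r j`. -/
def rgtAt (j : NExp) : NExp := .get .rgt j (.lit 0)

/-- The term `s(a) + v y` for a client of the left side, `s(a) - v y` for the right side. -/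
def frontExp : Side → NExp → WExp → WExp
  | .L, a, y => .add (sOf a) (.mul (.reg .v) y)
  | .R, a, y => .sub (sOf a) (.mul (.reg .v) y)

/-- The term `|s(a)| / (1 + v)`. -/
def firstExp (a : NExp) : WExp := .div (.abs (sOf a)) (.add .one (.reg .v))

/-- `a` starts on the left. -/
def isLeft (a : NExp) : BExp := .wordLe (sOf a) .zero

/-- `b` precedes `a` in the order by distance from the origin; ties are broken by the index. -/
def precedes : BExp :=
  .or (.wordLt (.abs (sOf (.reg .b))) (.abs (sOf (.reg .a))))
    (.and (.wordLe (.abs (sOf (.reg .b))) (.abs (sOf (.reg .a)))) (.natLt (.reg .b) (.reg .a)))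

/-- Sort both sides: client `a` is stored at the position that is determined by the number of
clients of its side that precede it. -/
def sortCmd : Cmd :=
  .block [
    .setN .nL (.lit 0),
    .setN .nR (.lit 0),
    .forLoop .a (.lit 0) (.reg .n) (.block [
      .setN .k (.lit 1),
      .ite (isLeft (.reg .a))
        (.block [
          .forLoop .b (.lit 0) (.reg .n)
            (.ite (.and (isLeft (.reg .b)) precedes) (.setN .k (.add (.reg .k) (.lit 1))) .skip),
          .setNArr .lft (.reg .k) (.lit 0) (.reg .a),
          .setN .nL (.add (.reg .nL) (.lit 1))])
        (.block [
          .forLoop .b (.lit 0) (.reg .n)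
            (.ite (.and (.not (isLeft (.reg .b))) precedes)
              (.setN .k (.add (.reg .k) (.lit 1))) .skip),
          .setNArr .rgt (.reg .k) (.lit 0) (.reg .a),
          .setN .nR (.add (.reg .nR) (.lit 1))])])]

/-- Check the deadlines of the first clients. -/
def checkCmd : Cmd :=
  .block [
    .setN .ok (.lit 1),
    .ite (.and (.natLt (.lit 0) (.reg .nL))
        (.not (.wordLe (firstExp (lftAt (.lit 1))) (dOf (lftAt (.lit 1))))))
      (.setN .ok (.lit 0)) .skip,
    .ite (.and (.natLt (.lit 0) (.reg .nR))
        (.not (.wordLe (firstExp (rgtAt (.lit 1))) (dOf (rgtAt (.lit 1))))))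
      (.setN .ok (.lit 0)) .skip]

/-- Store `D(S') + T(S', S)` in the register `c`, where `D(S')` is the value of `e`, the state `S'`
ends with client `a'` of side `side'`, and the state `S` with the client in register `a`, of side
`side`. -/
def relaxCmd (c : WReg) (e : WExp) (side' : Side) (a' : NExp) (side : Side) : Cmd :=
  .block [
    .setW .y e,
    .setW .gap (.div (.abs (.sub (frontExp side' a' (.reg .y))
      (frontExp side (.reg .a) (.reg .y)))) (.add .one (.reg .v))),
    .ite (.wordLe (.add (.reg .y) (.reg .gap)) (dOf (.reg .a)))
      (.setW c (.add (.reg .y) (.reg .gap))) (.setW c .inf)]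

/-- Compute `D(i, j, L)` and the side of the best preceding state (`0` for `L`, `1` for `R`). -/
def cellLCmd : Cmd :=
  .ite (.natEq (.reg .i) (.lit 0))
    (.setWArr .DL (.reg .i) (.reg .j) .inf)
    (.ite (.and (.natEq (.reg .i) (.lit 1)) (.natEq (.reg .j) (.lit 0)))
      (.setWArr .DL (.reg .i) (.reg .j) (firstExp (lftAt (.lit 1))))
      (.block [
        .setN .a (lftAt (.reg .i)),
        relaxCmd .c₁ (.get .DL (.sub (.reg .i) (.lit 1)) (.reg .j)) .L
          (lftAt (.sub (.reg .i) (.lit 1))) .L,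
        relaxCmd .c₂ (.get .DR (.sub (.reg .i) (.lit 1)) (.reg .j)) .R (rgtAt (.reg .j)) .L,
        .ite (.wordLe (.reg .c₁) (.reg .c₂))
          (.block [.setWArr .DL (.reg .i) (.reg .j) (.reg .c₁),
            .setNArr .predL (.reg .i) (.reg .j) (.lit 0)])
          (.block [.setWArr .DL (.reg .i) (.reg .j) (.reg .c₂),
            .setNArr .predL (.reg .i) (.reg .j) (.lit 1)])]))

/-- Compute `D(i, j, R)` and the side of the best preceding state (`0` for `L`, `1` for `R`). -/
def cellRCmd : Cmd :=
  .ite (.natEq (.reg .j) (.lit 0))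
    (.setWArr .DR (.reg .i) (.reg .j) .inf)
    (.ite (.and (.natEq (.reg .i) (.lit 0)) (.natEq (.reg .j) (.lit 1)))
      (.setWArr .DR (.reg .i) (.reg .j) (firstExp (rgtAt (.lit 1))))
      (.block [
        .setN .a (rgtAt (.reg .j)),
        relaxCmd .c₁ (.get .DL (.reg .i) (.sub (.reg .j) (.lit 1))) .L (lftAt (.reg .i)) .R,
        relaxCmd .c₂ (.get .DR (.reg .i) (.sub (.reg .j) (.lit 1))) .R
          (rgtAt (.sub (.reg .j) (.lit 1))) .R,
        .ite (.wordLe (.reg .c₁) (.reg .c₂))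
          (.block [.setWArr .DR (.reg .i) (.reg .j) (.reg .c₁),
            .setNArr .predR (.reg .i) (.reg .j) (.lit 0)])
          (.block [.setWArr .DR (.reg .i) (.reg .j) (.reg .c₂),
            .setNArr .predR (.reg .i) (.reg .j) (.lit 1)])]))

/-- Fill the table in lexicographic order. -/
def tableCmd : Cmd :=
  .forLoop .i (.lit 0) (.add (.reg .nL) (.lit 1))
    (.forLoop .j (.lit 0) (.add (.reg .nR) (.lit 1)) (.block [cellLCmd, cellRCmd]))

/-- Compute the makespan. -/
def finishCmd : Cmd :=
  .block [
    .setW .y (.get .DL (.reg .nL) (.reg .nR)),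
    .setW .c₁ (.add (.reg .y) (.abs (frontExp .L (lftAt (.reg .nL)) (.reg .y)))),
    .setW .y (.get .DR (.reg .nL) (.reg .nR)),
    .setW .c₂ (.add (.reg .y) (.abs (frontExp .R (rgtAt (.reg .nR)) (.reg .y)))),
    .ite (.wordLe (.reg .c₁) (.reg .c₂))
      (.block [.setW .out (.reg .c₁), .setN .side (.lit 0)])
      (.block [.setW .out (.reg .c₂), .setN .side (.lit 1)]),
    .ite (.natEq (.reg .ok) (.lit 0)) (.setW .out .inf) .skip]

/-- Trace the minimizing path through the table backwards, and write the time and the position of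
every rendezvous into the arrays `t` and `x`. -/
def traceCmd : Cmd :=
  .ite (.wordLt (.reg .out) .inf)
    (.block [
      .setN .i (.reg .nL),
      .setN .j (.reg .nR),
      .forLoop .k (.lit 0) (.reg .n)
        (.ite (.natEq (.reg .side) (.lit 0))
          (.block [
            .setN .a (lftAt (.reg .i)),
            .setW .y (.get .DL (.reg .i) (.reg .j)),
            .setWArr .t (.reg .a) (.lit 0) (.reg .y),
            .setWArr .x (.reg .a) (.lit 0) (frontExp .L (.reg .a) (.reg .y)),
            .setN .side (.get .predL (.reg .i) (.reg .j)),
            .setN .i (.sub (.reg .i) (.lit 1))])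
          (.block [
            .setN .a (rgtAt (.reg .j)),
            .setW .y (.get .DR (.reg .i) (.reg .j)),
            .setWArr .t (.reg .a) (.lit 0) (.reg .y),
            .setWArr .x (.reg .a) (.lit 0) (frontExp .R (.reg .a) (.reg .y)),
            .setN .side (.get .predR (.reg .i) (.reg .j)),
            .setN .j (.sub (.reg .j) (.lit 1))]))])
    .skip

/-- The program. It returns the makespan (or `∞` if the instance is infeasible) in the register
`out` and the rendezvous of an optimal solution in the arrays `t` and `x`. -/
def dpProgram : Cmd := .block [sortCmd, checkCmd, tableCmd, finishCmd, traceCmd]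

/-- The initial memory: the number of clients, their speed, positions and deadlines. All other
cells are `0`. -/
noncomputable def Inst.input {n : ℕ} (I : Inst n) : Mem ℝ where
  nreg
    | .n => n
    | _ => 0
  narr _ _ _ := 0
  wreg
    | .v => (I.v : WithTop ℝ)
    | _ => ((0 : ℝ) : WithTop ℝ)
  warr x p q :=
    match x with
    | .s => if h : p < n ∧ q = 0 then (I.s ⟨p, h.1⟩ : WithTop ℝ) else ((0 : ℝ) : WithTop ℝ)
    | .d => if h : p < n ∧ q = 0 then I.d ⟨p, h.1⟩ else ((0 : ℝ) : WithTop ℝ)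
    | _ => ((0 : ℝ) : WithTop ℝ)

/-- The final memory of a run describes the solution `S`. -/
def Returns {n : ℕ} (m : Mem ℝ) (S : Solution n) : Prop :=
  m.wreg .out = (S.makespan : WithTop ℝ) ∧
  ∀ a : Fin n, m.warr .t a 0 = (S.t a : WithTop ℝ) ∧ m.warr .x a 0 = (S.x a : WithTop ℝ)

end CLTSP

namespace CLTSP

/-! ## Correctness of the recursion -/

/-! The front of a client is its position if it moves at full speed towards the origin and beyond.
This is the extreme position that the client can have at a given time. The table considers only
tours that meet every client on its front and the clients of each side by non-decreasing distance;
the point is that such tours suffice.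

Lower bound. Given a feasible solution, a second server follows the table so that at every
rendezvous of the solution it can be at the same place at the same time, with at least the same
clients served (`Reach`, `exists_reach`). When the solution meets a client at `x`, the front of this
client and the fronts of all closer clients of its side are at `x` or past it. The second server has
not been passed by the fronts of the clients it still has to serve (`Between`, `between_of_tab`), so
it meets these clients on its way to `x` without losing time (`Ahead.meet`). Their deadlines are
respected because the solution itself serves them at this time or later. Keeping only the earliest
time of each state loses nothing: as `v < 1`, a server that is early can accompany the client it has
met (`abs_front_sub`). This gives `dpValue_le`.

Upper bound. Along a minimizing path, `Between` shows that the server always runs straight towards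
the next front, so every transition time is the distance travelled. The path, traced backwards, is
therefore a feasible schedule (`exists_feasible_of_trace`). Only the first deadline on the path is
not tested by the recursion; `FirstInTime` supplies it.

Program. Loop invariants show that the memory holds an ordering, then the table, then the traced
rendezvous; a syntactic frame rule (`Cmd.Keeps.run`) takes care of all cells that a piece of code
does not touch. The number of steps is bounded by a polynomial in the loop lengths whose degree is
the nesting depth, which is two. -/

/-- The direction in which the clients of a side move. -/
def Side.sgn : Side → ℝ
  | .L => 1
  | .R => -1

lemma Side.sgn_eq (δ : Side) : δ.sgn = 1 ∨ δ.sgn = -1 := by cases δ <;> simp [Side.sgn]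

lemma Side.sgn_of_ne {δ δ' : Side} (h : δ' ≠ δ) : δ'.sgn = -δ.sgn := by
  cases δ <;> cases δ' <;> simp_all [Side.sgn]

/-- The enumeration of the clients of a side. -/
def Side.ord {n : ℕ} (ℓ r : ℕ → Fin n) : Side → ℕ → Fin n
  | .L => ℓ
  | .R => r

/-- Numbers of served clients after serving one more client of side `δ`. -/
def bump (c : Side → ℕ) (δ : Side) : Side → ℕ := Function.update c δ (c δ + 1)

/-- Numbers of served clients before serving the last client of side `δ`. -/
def drop (c : Side → ℕ) (δ : Side) : Side → ℕ := Function.update c δ (c δ - 1)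

@[simp] lemma bump_same (c : Side → ℕ) (δ : Side) : bump c δ δ = c δ + 1 := by simp [bump]

lemma bump_of_ne (c : Side → ℕ) {δ δ' : Side} (h : δ' ≠ δ) : bump c δ δ' = c δ' := by
  simp [bump, h]

lemma le_bump (c : Side → ℕ) (δ δ' : Side) : c δ' ≤ bump c δ δ' := by
  by_cases h : δ' = δ
  · subst h; simp
  · rw [bump_of_ne c h]

@[simp] lemma drop_same (c : Side → ℕ) (δ : Side) : drop c δ δ = c δ - 1 := by simp [drop]

lemma drop_le (c : Side → ℕ) (δ δ' : Side) : drop c δ δ' ≤ c δ' := by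
  by_cases h : δ' = δ
  · subst h; simp
  · simp [drop, h]

lemma bump_drop {c : Side → ℕ} {δ : Side} (h : c δ ≠ 0) : bump (drop c δ) δ = c := by
  have : c δ - 1 + 1 = c δ := by omega
  simp [bump, drop, this]

lemma drop_add {c : Side → ℕ} {δ : Side} (h : c δ ≠ 0) :
    drop c δ .L + drop c δ .R + 1 = c .L + c .R := by
  cases δ <;> simp [drop] <;> omega

lemma counts_eq_zero_iff (c : Side → ℕ) : c = 0 ↔ c .L + c .R = 0 := by
  constructor
  · rintro rfl; rfl
  · intro h; funext δ; cases δ <;> simp <;> omega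

namespace Inst

variable {n : ℕ} (I : Inst n) (ℓ r : ℕ → Fin n)

/-- The clients that start on a given side. -/
noncomputable def clients : Side → Finset (Fin n)
  | .L => I.left
  | .R => I.right

/-- The table, indexed by the numbers of served clients of the two sides. -/
noncomputable def tab (c : Side → ℕ) (δ : Side) : WithTop ℝ := I.table ℓ r (c .L) (c .R) δ

/-- The value of the state `(bump c δ, δ)` if the preceding state is `(c, δ')`. -/
noncomputable def cand (c : Side → ℕ) (δ δ' : Side) : WithTop ℝ :=
  I.tab ℓ r c δ' + I.transition δ' (δ'.ord ℓ r (c δ')) δ (δ.ord ℓ r (c δ + 1)) (I.tab ℓ r c δ')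

/-- The side of the best state that precedes `(bump c δ, δ)`. -/
noncomputable def predSide (c : Side → ℕ) (δ : Side) : Side :=
  if I.cand ℓ r c δ .L ≤ I.cand ℓ r c δ .R then .L else .R

lemma tab_eq_top {c : Side → ℕ} {δ : Side} (h : c δ = 0) : I.tab ℓ r c δ = ⊤ := by
  cases δ <;> simp only [tab, h] <;> rw [Inst.table]

lemma tab_bump_zero (δ : Side) :
    I.tab ℓ r (bump 0 δ) δ = ((|I.s (δ.ord ℓ r 1)| / (1 + I.v) : ℝ) : WithTop ℝ) := by
  cases δ <;> simp [tab, bump, Side.ord, Inst.table]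

lemma tab_bump {c : Side → ℕ} (hc : c ≠ 0) (δ : Side) :
    I.tab ℓ r (bump c δ) δ = min (I.cand ℓ r c δ .L) (I.cand ℓ r c δ .R) := by
  have hc' : ¬ (c .L = 0 ∧ c .R = 0) := fun h => hc ((counts_eq_zero_iff c).2 (by omega))
  cases δ
  · have e : bump c .L .R = c .R := bump_of_ne c (by decide)
    rw [tab, e, bump_same, Inst.table, if_neg hc']
    rfl
  · have e : bump c .R .L = c .L := bump_of_ne c (by decide)
    rw [tab, e, bump_same, Inst.table, if_neg hc']
    rfl

lemma tab_bump_eq_cand {c : Side → ℕ} (hc : c ≠ 0) (δ : Side) :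
    I.tab ℓ r (bump c δ) δ = I.cand ℓ r c δ (I.predSide ℓ r c δ) := by
  rw [tab_bump I ℓ r hc, predSide]
  split_ifs with h
  · exact min_eq_left h
  · exact min_eq_right (le_of_not_ge h)

lemma tab_bump_le {c : Side → ℕ} (hc : c ≠ 0) (δ δ' : Side) :
    I.tab ℓ r (bump c δ) δ ≤ I.cand ℓ r c δ δ' := by
  rw [tab_bump I ℓ r hc]
  cases δ'
  · exact min_le_left _ _
  · exact min_le_right _ _

/-- The time that the server needs from position `p` at time `y` to the front of client `a`. -/
noncomputable def gap (δ : Side) (a : Fin n) (y p : ℝ) : ℝ := |p - I.front δ a y| / (1 + I.v)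

lemma front_eq (δ : Side) (a : Fin n) (t : ℝ) : I.front δ a t = I.s a + δ.sgn * (I.v * t) := by
  cases δ <;> simp [front, Side.sgn, sub_eq_add_neg]

lemma transition_coe (δ' δ : Side) (a' a : Fin n) (y : ℝ) :
    I.transition δ' a' δ a y =
      if ((y + I.gap δ a y (I.front δ' a' y) : ℝ) : WithTop ℝ) ≤ I.d a
      then (I.gap δ a y (I.front δ' a' y) : WithTop ℝ) else ⊤ := rfl

lemma cand_of_coe {c : Side → ℕ} {δ δ' : Side} {y : ℝ} (h : I.tab ℓ r c δ' = y)
    (hd : ((y + I.gap δ (δ.ord ℓ r (c δ + 1)) y (I.front δ' (δ'.ord ℓ r (c δ')) y) : ℝ) :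
      WithTop ℝ) ≤ I.d (δ.ord ℓ r (c δ + 1))) :
    I.cand ℓ r c δ δ' =
      ((y + I.gap δ (δ.ord ℓ r (c δ + 1)) y (I.front δ' (δ'.ord ℓ r (c δ')) y) : ℝ) :
        WithTop ℝ) := by
  rw [cand, h, transition_coe, if_pos hd, ← WithTop.coe_add]

/-- A candidate is infinite when the preceding value is infinite or the deadline is missed, so a
finite one gives back both a time for the preceding state and the deadline. -/
lemma exists_of_cand_eq_coe {c : Side → ℕ} {δ δ' : Side} {z : ℝ} (h : I.cand ℓ r c δ δ' = z) :
    ∃ y : ℝ, I.tab ℓ r c δ' = y ∧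
      z = y + I.gap δ (δ.ord ℓ r (c δ + 1)) y (I.front δ' (δ'.ord ℓ r (c δ')) y) ∧
      (z : WithTop ℝ) ≤ I.d (δ.ord ℓ r (c δ + 1)) := by
  rw [cand] at h
  cases hy : I.tab ℓ r c δ' with
  | top => rw [hy] at h; simp at h
  | coe y =>
    rw [hy, transition_coe] at h
    split_ifs at h with hd
    · rw [← WithTop.coe_add, WithTop.coe_inj] at h
      subst h
      exact ⟨y, rfl, rfl, hd⟩
    · simp at h

/-! ### Geometry of a single move -/

/-- The client `a` has not yet been passed by a server that is at position `p` at time `y`. -/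
def Ahead (δ : Side) (a : Fin n) (y p : ℝ) : Prop := 0 ≤ δ.sgn * (p - I.front δ a y)

variable {I}

lemma gap_nonneg (hv : I.SlowClients) (δ : Side) (a : Fin n) (y p : ℝ) : 0 ≤ I.gap δ a y p :=
  div_nonneg (abs_nonneg _) (by linarith [hv.1])

/-- Server and front approach each other at relative speed `1 + v`. Being ahead fixes the sign of
their separation, which removes the absolute value. -/
lemma Ahead.mul_gap (hv : I.SlowClients) {δ : Side} {a : Fin n} {y p : ℝ} (h : I.Ahead δ a y p) :
    (1 + I.v) * I.gap δ a y p = δ.sgn * (p - I.front δ a y) := by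
  have h0 : (1 + I.v) ≠ 0 := by linarith [hv.1]
  rw [gap, mul_div_cancel₀ _ h0, ← abs_of_nonneg h, abs_mul]
  rcases δ.sgn_eq with e | e <;> simp [e]

/-- The meeting point, seen from the server: it has run at unit speed against the direction of the
client. -/
lemma Ahead.front_add_gap (hv : I.SlowClients) {δ : Side} {a : Fin n} {y p : ℝ}
    (h : I.Ahead δ a y p) :
    I.front δ a (y + I.gap δ a y p) = p - δ.sgn * I.gap δ a y p := by
  have := h.mul_gap hv
  have e := I.front_eq δ a y
  rw [front_eq]
  rcases δ.sgn_eq with e' | e' <;> rw [e'] at this e ⊢ <;> linarith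

/-- Fronts of the same side keep a constant offset, so a client that starts behind `a` stays behind
it. -/
lemma Ahead.of_behind {δ : Side} {a b : Fin n} (t : ℝ)
    (hs : 0 ≤ δ.sgn * (I.s a - I.s b)) : I.Ahead δ b t (I.front δ a t) := by
  simp only [Ahead, front_eq]
  linarith

/-- While the server runs towards a client of side `δ`, it moves in the same direction as the
clients of the other side, and faster since `v < 1`. They cannot overtake it. -/
lemma Ahead.of_other_side (hv : I.SlowClients) {δ δ' : Side} (hne : δ' ≠ δ) {b : Fin n}
    {y p w : ℝ} (hw : 0 ≤ w) (h : I.Ahead δ' b y p) :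
    I.Ahead δ' b (y + w) (p - δ.sgn * w) := by
  have hw' : I.v * w ≤ w := by nlinarith [hv.2]
  simp only [Ahead, front_eq, Side.sgn_of_ne hne] at *
  rcases δ.sgn_eq with e' | e' <;> rw [e'] at h ⊢ <;> linarith

/-- A server that reaches a point beyond the front of `a` can meet `a` on the way. -/
lemma Ahead.meet (hv : I.SlowClients) {δ : Side} {a : Fin n} {y p t x : ℝ}
    (h : I.Ahead δ a y p) (hr : |x - p| ≤ t - y) (hx : δ.sgn * (x - I.front δ a t) ≤ 0) :
    |x - I.front δ a (y + I.gap δ a y p)| ≤ t - (y + I.gap δ a y p) := by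
  have hg := h.mul_gap hv
  rw [h.front_add_gap hv]
  have e1 := I.front_eq δ a y
  have e2 := I.front_eq δ a t
  obtain ⟨hv0, hv1⟩ := hv
  rw [abs_le] at *
  -- The separation of server and front is `(1 + v) * gap` at time `y`, is not positive at time `t`,
  -- and shrinks at rate at most `1 + v`.
  have hle : I.gap δ a y p ≤ t - y := by
    have : (1 + I.v) * I.gap δ a y p ≤ (1 + I.v) * (t - y) := by
      rw [hg]
      rcases δ.sgn_eq with e' | e' <;> rw [e'] at e1 e2 hx ⊢ <;> linarith
    exact le_of_mul_le_mul_left this (by linarith)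
  -- One of the two bounds is the speed limit between `p` and `x`. The other holds because at time
  -- `t` the front is at `x` or past it, and it has drifted only at speed `v` since the meeting.
  have hle' : I.v * (t - y - I.gap δ a y p) ≤ t - y - I.gap δ a y p := by nlinarith
  rcases δ.sgn_eq with e' | e' <;> rw [e'] at hg e1 e2 hx ⊢ <;> constructor <;> linarith

/-- A server can accompany a client on its front because `v < 1`. Hence meeting a client earlier is
never a disadvantage. -/
lemma abs_front_sub (hv : I.SlowClients) (δ : Side) (a : Fin n) {y z : ℝ} (h : z ≤ y) :
    |I.front δ a y - I.front δ a z| ≤ y - z := by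
  have e : I.front δ a y - I.front δ a z = δ.sgn * (I.v * (y - z)) := by
    rw [front_eq, front_eq]; ring
  have h1 : I.v * (y - z) ≤ y - z := by nlinarith [hv.2]
  have h2 : 0 ≤ I.v * (y - z) := mul_nonneg hv.1.le (by linarith)
  rw [e, abs_le]
  rcases δ.sgn_eq with e' | e' <;> rw [e'] <;> constructor <;> linarith

/-! ### The order of the clients -/

variable {ℓ r}

lemma mem_clients {δ : Side} {a : Fin n} : a ∈ I.clients δ ↔
    match δ with | .L => I.s a ≤ 0 | .R => 0 < I.s a := by
  cases δ <;> simp [clients, left, right]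

lemma sgn_mul_nonpos {δ : Side} {a : Fin n} (h : a ∈ I.clients δ) : δ.sgn * I.s a ≤ 0 := by
  rw [mem_clients] at h
  cases δ <;> simp only [Side.sgn] at * <;> linarith

lemma sgn_mul_eq {δ : Side} {a : Fin n} (h : a ∈ I.clients δ) : δ.sgn * I.s a = -|I.s a| := by
  rw [mem_clients] at h
  cases δ <;> simp only [Side.sgn] at *
  · rw [abs_of_nonpos h]; ring
  · rw [abs_of_pos h]; ring

lemma exists_mem_clients (I : Inst n) (a : Fin n) : ∃ δ, a ∈ I.clients δ := by
  rcases le_or_gt (I.s a) 0 with h | h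
  · exact ⟨.L, mem_clients.2 h⟩
  · exact ⟨.R, mem_clients.2 h⟩

lemma side_unique {δ δ' : Side} {a : Fin n} (h : a ∈ I.clients δ) (h' : a ∈ I.clients δ') :
    δ = δ' := by
  rw [mem_clients] at h h'
  cases δ <;> cases δ' <;> simp_all
  all_goals linarith

lemma card_clients (I : Inst n) : (I.clients .L).card + (I.clients .R).card = n := by
  have := Finset.card_filter_add_card_filter_not (s := (Finset.univ : Finset (Fin n)))
    (fun a => I.s a ≤ 0)
  simpa [clients, left, right, not_le] using this

lemma IsOrdering.bijOn (h : I.IsOrdering ℓ r) (δ : Side) :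
    Set.BijOn (δ.ord ℓ r) (Set.Icc 1 (I.clients δ).card) (I.clients δ) := by
  cases δ
  · exact h.left_bij
  · exact h.right_bij

lemma IsOrdering.mem (h : I.IsOrdering ℓ r) {δ : Side} {k : ℕ} (h1 : 1 ≤ k)
    (h2 : k ≤ (I.clients δ).card) : δ.ord ℓ r k ∈ I.clients δ :=
  (h.bijOn δ).mapsTo ⟨h1, h2⟩

/-- The enumeration by distance is an order of the fronts: a client with a smaller index is at least
as far along in the direction of its side. -/
lemma IsOrdering.mono (h : I.IsOrdering ℓ r) {δ : Side} {i j : ℕ} (h1 : 1 ≤ i) (h2 : i ≤ j)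
    (h3 : j ≤ (I.clients δ).card) : 0 ≤ δ.sgn * (I.s (δ.ord ℓ r i) - I.s (δ.ord ℓ r j)) := by
  rw [mul_sub, sgn_mul_eq (h.mem h1 (h2.trans h3)), sgn_mul_eq (h.mem (h1.trans h2) h3)]
  have : |I.s (δ.ord ℓ r i)| ≤ |I.s (δ.ord ℓ r j)| := by
    cases δ
    · exact h.left_mono i j h1 h2 h3
    · exact h.right_mono i j h1 h2 h3
  linarith

variable (I ℓ r) in
/-- At time `y`, a server at position `p` that has served the first `c δ` clients of side `δ` has
passed none of the other clients. -/
def Between (c : Side → ℕ) (y p : ℝ) : Prop :=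
  0 ≤ y ∧ ∀ δ k, c δ ≤ k → 1 ≤ k → k ≤ (I.clients δ).card → I.Ahead δ (δ.ord ℓ r k) y p

lemma between_zero (h : I.IsOrdering ℓ r) : I.Between ℓ r 0 0 0 := by
  refine ⟨le_rfl, fun δ k _ h1 h2 => ?_⟩
  have := sgn_mul_nonpos (h.mem h1 h2)
  simp only [Ahead, front_eq]
  linarith

lemma Between.bump (hv : I.SlowClients) (h : I.IsOrdering ℓ r) {c : Side → ℕ} {y p : ℝ}
    (hb : I.Between ℓ r c y p) {δ : Side} (hδ : c δ + 1 ≤ (I.clients δ).card) :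
    I.Between ℓ r (bump c δ) (y + I.gap δ (δ.ord ℓ r (c δ + 1)) y p)
      (I.front δ (δ.ord ℓ r (c δ + 1)) (y + I.gap δ (δ.ord ℓ r (c δ + 1)) y p)) := by
  have hg := gap_nonneg hv δ (δ.ord ℓ r (c δ + 1)) y p
  refine ⟨add_nonneg hb.1 hg, fun δ' k hk h1 h2 => ?_⟩
  by_cases hne : δ' = δ
  -- The server stands on the front of the client just met, and the later fronts of this side trail
  -- it.
  · subst hne
    rw [bump_same] at hk
    exact Ahead.of_behind _ (h.mono (by omega) hk h2)
  · rw [bump_of_ne c hne] at hk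
    rw [(hb.2 δ (c δ + 1) (by omega) (by omega) hδ).front_add_gap hv]
    exact (hb.2 δ' k hk h1 h2).of_other_side hv hne hg

lemma gap_zero (δ : Side) (a : Fin n) : I.gap δ a 0 0 = |I.s a| / (1 + I.v) := by
  simp [gap, front_eq]

lemma exists_tab_pred {c : Side → ℕ} (hc : c ≠ 0) {δ : Side} {z : ℝ}
    (hz : I.tab ℓ r (CLTSP.bump c δ) δ = z) :
    ∃ y : ℝ, I.tab ℓ r c (I.predSide ℓ r c δ) = y ∧
      z = y + I.gap δ (δ.ord ℓ r (c δ + 1)) y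
        (I.front (I.predSide ℓ r c δ) ((I.predSide ℓ r c δ).ord ℓ r (c (I.predSide ℓ r c δ))) y) ∧
      (z : WithTop ℝ) ≤ I.d (δ.ord ℓ r (c δ + 1)) :=
  I.exists_of_cand_eq_coe ℓ r ((I.tab_bump_eq_cand ℓ r hc δ).symm.trans hz)

/-- Induction on the number of served clients along the path that attains the minimum. The absolute
values in the transition times can be resolved only because of this invariant. -/
lemma between_of_tab (hv : I.SlowClients) (h : I.IsOrdering ℓ r) {c : Side → ℕ} {δ : Side} {y : ℝ}
    (hc : ∀ δ, c δ ≤ (I.clients δ).card) (hy : I.tab ℓ r c δ = y) :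
    I.Between ℓ r c y (I.front δ (δ.ord ℓ r (c δ)) y) := by
  induction hN : c .L + c .R generalizing c δ y with
  | zero =>
    rw [← counts_eq_zero_iff] at hN
    subst hN
    rw [tab_eq_top _ _ _ rfl] at hy
    simp at hy
  | succ N ih =>
    have hδ : c δ ≠ 0 := fun h0 => by rw [tab_eq_top _ _ _ h0] at hy; simp at hy
    have hd := drop_add hδ
    -- Undo the last service, so that the state has the form `bump c' δ` and the recursion applies.
    obtain ⟨c', hc', hN', hle⟩ : ∃ c', CLTSP.bump c' δ = c ∧ c' .L + c' .R = N ∧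
        ∀ δ, c' δ ≤ c δ := ⟨_, bump_drop hδ, by omega, drop_le c δ⟩
    subst hc'
    have hδ' := hc δ
    rw [bump_same] at hδ' ⊢
    by_cases h0 : c' = 0
    · subst h0
      have hyy := hy
      rw [tab_bump_zero, WithTop.coe_inj] at hyy
      have := (between_zero h).bump hv h (δ := δ) hδ'
      simp only [Pi.zero_apply, zero_add, gap_zero, hyy] at this ⊢
      exact this
    · obtain ⟨y', hy', rfl, -⟩ := exists_tab_pred h0 hy
      exact (ih (fun δ => (hle δ).trans (hc δ)) hy' hN').bump hv h hδ'

/-! ### Lower bound -/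

variable (I ℓ r) in
/-- A server that follows the table can be at position `x` at time `t` after it has served the first
`c δ` clients of side `δ`. -/
def Reach (c : Side → ℕ) (t x : ℝ) : Prop :=
  (c = 0 ∧ |x| ≤ t) ∨
    ∃ δ, ∃ y : ℝ, I.tab ℓ r c δ = y ∧ |x - I.front δ (δ.ord ℓ r (c δ)) y| ≤ t - y

lemma Reach.move {c : Side → ℕ} {t x t' x' : ℝ} (h : I.Reach ℓ r c t x)
    (hm : t + |x' - x| ≤ t') : I.Reach ℓ r c t' x' := by
  rcases h with ⟨hc, h⟩ | ⟨δ, y, hy, h⟩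
  · left
    refine ⟨hc, ?_⟩
    have := abs_add_le (x' - x) x
    rw [sub_add_cancel] at this
    linarith
  · right
    refine ⟨δ, y, hy, ?_⟩
    have := abs_sub_le x' x (I.front δ (δ.ord ℓ r (c δ)) y)
    linarith

/-- If the front of the next client has arrived at `x` or passed it, the server following the table
meets this client on its way to `x`. The meeting is not later than `t`, so a deadline of at least
`t` makes the transition finite. -/
lemma Reach.bump (hv : I.SlowClients) (h : I.IsOrdering ℓ r) {c : Side → ℕ} {t x : ℝ}
    (hR : I.Reach ℓ r c t x) (hc : ∀ δ, c δ ≤ (I.clients δ).card) {δ : Side}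
    (hδ : c δ + 1 ≤ (I.clients δ).card) (hd : (t : WithTop ℝ) ≤ I.d (δ.ord ℓ r (c δ + 1)))
    (hx : δ.sgn * (x - I.front δ (δ.ord ℓ r (c δ + 1)) t) ≤ 0) :
    I.Reach ℓ r (bump c δ) t x := by
  right
  refine ⟨δ, ?_⟩
  rw [bump_same]
  rcases hR with ⟨rfl, h0⟩ | ⟨δ', y, hy, hr⟩
  · have hm := ((between_zero h).2 δ 1 (by simp) le_rfl (by simpa using hδ)).meet hv
      (t := t) (x := x) (by simpa using h0) (by simpa using hx)
    rw [gap_zero, zero_add] at hm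
    exact ⟨_, tab_bump_zero _ _ _ _, hm⟩
  · have hc0 : c ≠ 0 := by
      rintro rfl
      rw [tab_eq_top _ _ _ rfl] at hy
      simp at hy
    have hm := ((between_of_tab hv h hc hy).2 δ (c δ + 1) (by omega) (by omega) hδ).meet hv hr hx
    set g := I.gap δ (δ.ord ℓ r (c δ + 1)) y (I.front δ' (δ'.ord ℓ r (c δ')) y)
    have hle : y + g ≤ t := by linarith [(abs_nonneg _).trans hm]
    -- The minimum may be attained by the other preceding state, with an earlier time `z`. From then
    -- on the server accompanies the client until `y + g` and continues as before.
    have hb := I.tab_bump_le ℓ r hc0 δ δ'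
    rw [I.cand_of_coe ℓ r hy ((WithTop.coe_le_coe.2 hle).trans hd)] at hb
    obtain ⟨z, hz, hzg⟩ := WithTop.le_coe_iff.1 hb
    refine ⟨z, hz, ?_⟩
    have h1 := abs_front_sub hv δ (δ.ord ℓ r (c δ + 1)) hzg
    have h2 := abs_sub_le x (I.front δ (δ.ord ℓ r (c δ + 1)) (y + g))
      (I.front δ (δ.ord ℓ r (c δ + 1)) z)
    linarith

/-- Iterates `Reach.bump` along one side, with `N` bounding the number of missing clients. The table
may already have served more than `q` clients, hence the inequalities in the conclusion. -/
lemma Reach.bump_until (hv : I.SlowClients) (h : I.IsOrdering ℓ r) {t x : ℝ} {δ : Side} {q : ℕ}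
    (hq : q ≤ (I.clients δ).card) (N : ℕ) {c : Side → ℕ}
    (hR : I.Reach ℓ r c t x) (hc : ∀ δ, c δ ≤ (I.clients δ).card)
    (hd : ∀ k, c δ < k → k ≤ q → (t : WithTop ℝ) ≤ I.d (δ.ord ℓ r k) ∧
      δ.sgn * (x - I.front δ (δ.ord ℓ r k) t) ≤ 0) (hN : q ≤ c δ + N) :
    ∃ c', (∀ δ, c δ ≤ c' δ) ∧ (∀ δ, c' δ ≤ (I.clients δ).card) ∧ q ≤ c' δ ∧
      I.Reach ℓ r c' t x := by
  induction N generalizing c with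
  | zero => exact ⟨c, fun _ => le_rfl, hc, hN, hR⟩
  | succ N ih =>
    by_cases hqc : q ≤ c δ
    · exact ⟨c, fun _ => le_rfl, hc, hqc, hR⟩
    · have hk := hd (c δ + 1) (by omega) (by omega)
      obtain ⟨c', h1, h2, h3, h4⟩ := ih (hR.bump hv h hc (by omega) hk.1 hk.2)
        (fun δ' => by
          by_cases hne : δ' = δ
          · subst hne; rw [bump_same]; omega
          · rw [bump_of_ne c hne]; exact hc δ')
        (fun k hk hkq => hd k (by rw [bump_same] at hk; omega) hkq)
        (by rw [bump_same]; omega)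
      exact ⟨c', fun δ' => (le_bump c δ δ').trans (h1 δ'), h2, h3, h4⟩

end Inst

/-! ### Feasible schedules compared with the table -/

section Schedule

variable {n : ℕ} {I : Inst n} {S : Solution n} {σ : Equiv.Perm (Fin n)}

lemma Inst.FeasibleInOrder.step (hF : I.FeasibleInOrder S σ) (hτ : I.ZeroProcessing) {k : ℕ}
    (hk : k ≤ n) :
    S.time σ k + |S.position σ (k + 1) - S.position σ k| ≤ S.time σ (k + 1) := by
  have h := hF.reachable_server (k + 1) (by omega) (by omega)
  have e : S.completion σ I.τ k = S.time σ k := by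
    cases k with
    | zero => rfl
    | succ k => simp [Solution.completion, Solution.time, hτ _]
  rwa [Nat.add_sub_cancel, e] at h

lemma Inst.FeasibleInOrder.time_mono (hF : I.FeasibleInOrder S σ) (hτ : I.ZeroProcessing)
    {k m : ℕ} (hkm : k ≤ m) (hm : m ≤ n + 1) : S.time σ k ≤ S.time σ m := by
  induction m, hkm using Nat.le_induction with
  | base => exact le_rfl
  | succ m _ ih =>
    have := hF.step hτ (k := m) (by omega)
    linarith [ih (by omega), abs_nonneg (S.position σ (m + 1) - S.position σ m)]

lemma Inst.FeasibleInOrder.abs_position_le (hF : I.FeasibleInOrder S σ) (hτ : I.ZeroProcessing)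
    {k : ℕ} (hk : k ≤ n + 1) : |S.position σ k| ≤ S.time σ k := by
  induction k with
  | zero => simp [Solution.position, Solution.time]
  | succ k ih =>
    have := hF.step hτ (k := k) (by omega)
    have h2 := abs_add_le (S.position σ (k + 1) - S.position σ k) (S.position σ k)
    rw [sub_add_cancel] at h2
    linarith [ih (by omega)]

lemma Solution.time_succ {k : ℕ} (hk : k < n) : S.time σ (k + 1) = S.t (σ ⟨k, hk⟩) := by
  simp [Solution.time, hk]

lemma Solution.position_succ {k : ℕ} (hk : k < n) : S.position σ (k + 1) = S.x (σ ⟨k, hk⟩) := by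
  simp [Solution.position, hk]

lemma Inst.FeasibleInOrder.abs_sub_le (hF : I.FeasibleInOrder S σ) (hr : I.DeadlinesOnly)
    (hv : I.SlowClients) (a : Fin n) : |S.x a - I.s a| ≤ I.v * S.t a := by
  have h := hF.reachable_client a
  rw [hr a, zero_add, div_le_iff₀ hv.1] at h
  linarith

/-- By its speed limit, no client can be met beyond its front, in either direction. -/
lemma Inst.FeasibleInOrder.passed (hF : I.FeasibleInOrder S σ) (hr : I.DeadlinesOnly)
    (hv : I.SlowClients) (δ : Side) (a : Fin n) :
    δ.sgn * (S.x a - I.front δ a (S.t a)) ≤ 0 := by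
  have h := abs_le.1 (hF.abs_sub_le hr hv a)
  rw [I.front_eq]
  rcases δ.sgn_eq with e | e <;> rw [e] <;> linarith

variable {ℓ r : ℕ → Fin n}

/-- The server of the table never falls behind the solution: `c` counts every client that the
solution has served, and possibly clients that it serves later. -/
lemma Inst.FeasibleInOrder.exists_reach (hF : I.FeasibleInOrder S σ) (hτ : I.ZeroProcessing)
    (hr : I.DeadlinesOnly) (hv : I.SlowClients) (h : I.IsOrdering ℓ r) (k : ℕ) (hk : k ≤ n) :
    ∃ c : Side → ℕ, (∀ δ, c δ ≤ (I.clients δ).card) ∧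
      I.Reach ℓ r c (S.time σ k) (S.position σ k) ∧
      ∀ m : Fin n, (m : ℕ) < k → ∀ δ q, 1 ≤ q → q ≤ (I.clients δ).card → δ.ord ℓ r q = σ m →
        q ≤ c δ := by
  induction k with
  | zero =>
    exact ⟨0, by simp, Or.inl ⟨rfl, by simp [Solution.position, Solution.time]⟩, by simp⟩
  | succ k ih =>
    obtain ⟨c, hc, hR, hserved⟩ := ih (by omega)
    have hR' := hR.move (hF.step hτ (k := k) (by omega))
    have hkn : k < n := by omega
    obtain ⟨δ, hδ⟩ := I.exists_mem_clients (σ ⟨k, hkn⟩)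
    obtain ⟨q, ⟨hq1, hq2⟩, hq⟩ := (h.bijOn δ).surjOn hδ
    obtain ⟨c', h1, h2, h3, h4⟩ := hR'.bump_until hv h hq2 q hc (fun k' hk' hk'q => by
      constructor
      · obtain ⟨m, hm⟩ := σ.surjective (δ.ord ℓ r k')
        -- A client not counted in `c` has not been served by the solution either. Its rendezvous is
        -- still to come, so its deadline is not before the current time.
        have hkm : k ≤ m := by
          by_contra hlt
          have := hserved m (by omega) δ k' (by omega) (by omega) hm.symm
          omega
        refine le_trans (WithTop.coe_le_coe.2
          (hF.time_mono hτ (Nat.succ_le_succ hkm) (by omega))) ?_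
        rw [Solution.time_succ m.2, ← hm]
        exact hF.deadline _
      -- The front of `q` is at the rendezvous or past it, and the closer clients of this side are
      -- at least as far along as `q`.
      · have hp := hF.passed hr hv δ (σ ⟨k, hkn⟩)
        have hm := h.mono (δ := δ) (i := k') (j := q) (by omega) hk'q hq2
        rw [Solution.time_succ hkn, Solution.position_succ hkn]
        rw [← hq, I.front_eq] at hp
        rw [← hq, I.front_eq]
        linarith) (by omega)
    refine ⟨c', h2, h4, fun m hm δ' q' hq'1 hq'2 hq' => ?_⟩
    rcases Nat.lt_succ_iff_lt_or_eq.1 hm with hlt | heq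
    · exact (hserved m hlt δ' q' hq'1 hq'2 hq').trans (h1 δ')
    · have hmk : m = ⟨k, hkn⟩ := Fin.ext heq
      subst hmk
      have hδ' : δ' = δ := Inst.side_unique (hq' ▸ h.mem hq'1 hq'2) hδ
      subst hδ'
      have : q' = q := (h.bijOn δ').injOn ⟨hq'1, hq'2⟩ ⟨hq1, hq2⟩ (hq'.trans hq.symm)
      omega

variable (I) in
/-- The numbers of clients of the two sides. -/
noncomputable def Inst.total (δ : Side) : ℕ := (I.clients δ).card

lemma Inst.total_ne_zero (hn : 1 ≤ n) : I.total ≠ 0 := by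
  rw [Ne, counts_eq_zero_iff]
  have := I.card_clients
  simp only [Inst.total]
  omega

/-- After the last rendezvous all clients are counted. The server of the table could still join the
solution there and return with it; returning directly is not longer. -/
lemma Inst.FeasibleInOrder.exists_tab_le (hF : I.FeasibleInOrder S σ) (hn : 1 ≤ n)
    (hτ : I.ZeroProcessing) (hr : I.DeadlinesOnly) (hv : I.SlowClients) (h : I.IsOrdering ℓ r) :
    ∃ δ, ∃ y : ℝ, I.tab ℓ r I.total δ = y ∧
      y + |I.front δ (δ.ord ℓ r (I.total δ)) y| ≤ S.makespan := by
  obtain ⟨c, hc, hR, hserved⟩ := hF.exists_reach hτ hr hv h n le_rfl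
  have hct : c = I.total := by
    funext δ
    refine le_antisymm (hc δ) ?_
    by_cases h0 : I.total δ = 0
    · omega
    · obtain ⟨m, hm⟩ := σ.surjective (δ.ord ℓ r (I.total δ))
      exact hserved m m.2 δ _ (by omega) le_rfl hm.symm
  subst hct
  rcases hR with ⟨h0, -⟩ | ⟨δ, y, hy, hle⟩
  · exact absurd h0 (Inst.total_ne_zero hn)
  · refine ⟨δ, y, hy, ?_⟩
    have hs := hF.step hτ (k := n) le_rfl
    have e1 : S.time σ (n + 1) = S.makespan := by simp [Solution.time, Solution.makespan]
    have e2 : S.position σ (n + 1) = 0 := by simp [Solution.position]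
    rw [e1, e2, zero_sub, abs_neg] at hs
    have h3 := abs_sub_abs_le_abs_sub (I.front δ (δ.ord ℓ r (I.total δ)) y) (S.position σ n)
    rw [abs_sub_comm] at h3
    linarith

/-- No client can be met before `|s| / (1 + v)`, the time needed if it and the server approach each
other from the start. So the test that the recursion omits for its initial states never rejects a
feasible instance. -/
lemma Inst.FeasibleInOrder.firstInTime (hF : I.FeasibleInOrder S σ) (hτ : I.ZeroProcessing)
    (hr : I.DeadlinesOnly) (hv : I.SlowClients) (ℓ r : ℕ → Fin n) : I.FirstInTime ℓ r := by
  have key : ∀ a, ((|I.s a| / (1 + I.v) : ℝ) : WithTop ℝ) ≤ I.d a := fun a => by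
    refine le_trans (WithTop.coe_le_coe.2 ?_) (hF.deadline a)
    obtain ⟨m, rfl⟩ := σ.surjective a
    have h1 := hF.abs_position_le hτ (k := m + 1) (by omega)
    rw [Solution.time_succ m.2, Solution.position_succ m.2] at h1
    have h2 := hF.abs_sub_le hr hv (σ m)
    have h3 := abs_sub_abs_le_abs_sub (I.s (σ m)) (S.x (σ m))
    rw [abs_sub_comm] at h3
    rw [div_le_iff₀ (by linarith [hv.1])]
    simp only [Fin.eta] at h1
    linarith
  exact ⟨fun _ => key _, fun _ => key _⟩

end Schedule

end CLTSP

namespace CLTSP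

/-! ### Reading off a schedule from the table -/

namespace Inst

variable {n : ℕ} (I : Inst n) (ℓ r : ℕ → Fin n) (δ₀ : Side)

/-- The states on a minimizing path, traced backwards from the final state of side `δ₀`. -/
noncomputable def trace : ℕ → (Side → ℕ) × Side
  | 0 => (I.total, δ₀)
  | k + 1 =>
      (drop (trace k).1 (trace k).2, I.predSide ℓ r (drop (trace k).1 (trace k).2) (trace k).2)

/-- The client of a state on the traced path. -/
noncomputable def traceClient (k : ℕ) : Fin n :=
  (I.trace ℓ r δ₀ k).2.ord ℓ r ((I.trace ℓ r δ₀ k).1 (I.trace ℓ r δ₀ k).2)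

/-- The value of a state on the traced path. -/
noncomputable def traceTime (k : ℕ) : ℝ :=
  (I.tab ℓ r (I.trace ℓ r δ₀ k).1 (I.trace ℓ r δ₀ k).2).untopD 0

/-- The position of the server in a state on the traced path. -/
noncomputable def tracePos (k : ℕ) : ℝ :=
  I.front (I.trace ℓ r δ₀ k).2 (I.traceClient ℓ r δ₀ k) (I.traceTime ℓ r δ₀ k)

variable {I ℓ r δ₀}

lemma tab_side_ne_zero {c : Side → ℕ} {δ : Side} {y : ℝ} (h : I.tab ℓ r c δ = y) : c δ ≠ 0 :=
  fun h0 => by rw [tab_eq_top _ _ _ h0] at h; simp at h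

lemma trace_antitone (δ : Side) : Antitone fun k => (I.trace ℓ r δ₀ k).1 δ :=
  antitone_nat_of_succ_le fun _ => drop_le _ _ _

lemma trace_le (k : ℕ) (δ : Side) : (I.trace ℓ r δ₀ k).1 δ ≤ (I.clients δ).card :=
  trace_antitone δ (Nat.zero_le k)

/-- Each step back removes one client, and a finite value has a finite predecessor as long as a
client remains. The bound `k < n` is sharp: with no client left the table is `⊤`. -/
lemma trace_finite {y₀ : ℝ} (h0 : I.tab ℓ r I.total δ₀ = y₀) (k : ℕ) (hk : k < n) :
    (∃ y : ℝ, I.tab ℓ r (I.trace ℓ r δ₀ k).1 (I.trace ℓ r δ₀ k).2 = y) ∧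
      (I.trace ℓ r δ₀ k).1 .L + (I.trace ℓ r δ₀ k).1 .R + k = n := by
  induction k with
  | zero => exact ⟨⟨y₀, h0⟩, I.card_clients⟩
  | succ k ih =>
    obtain ⟨⟨y, hy⟩, hsum⟩ := ih (by omega)
    have hne := tab_side_ne_zero hy
    have hd := drop_add hne
    constructor
    · have hc0 : drop (I.trace ℓ r δ₀ k).1 (I.trace ℓ r δ₀ k).2 ≠ 0 := by
        rw [Ne, counts_eq_zero_iff]; omega
      rw [← bump_drop hne] at hy
      obtain ⟨y', hy', -⟩ := exists_tab_pred hc0 hy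
      exact ⟨y', hy'⟩
    · simp only [trace]
      omega

lemma tab_trace {y₀ : ℝ} (h0 : I.tab ℓ r I.total δ₀ = y₀) {k : ℕ} (hk : k < n) :
    I.tab ℓ r (I.trace ℓ r δ₀ k).1 (I.trace ℓ r δ₀ k).2 = I.traceTime ℓ r δ₀ k := by
  obtain ⟨y, hy⟩ := (trace_finite h0 k hk).1
  rw [traceTime, hy]
  rfl

lemma trace_side_ne_zero {y₀ : ℝ} (h0 : I.tab ℓ r I.total δ₀ = y₀) {k : ℕ} (hk : k < n) :
    (I.trace ℓ r δ₀ k).1 (I.trace ℓ r δ₀ k).2 ≠ 0 := tab_side_ne_zero (tab_trace h0 hk)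

lemma traceClient_mem (h : I.IsOrdering ℓ r) {y₀ : ℝ} (h0 : I.tab ℓ r I.total δ₀ = y₀) {k : ℕ}
    (hk : k < n) : I.traceClient ℓ r δ₀ k ∈ I.clients (I.trace ℓ r δ₀ k).2 :=
  h.mem (Nat.one_le_iff_ne_zero.2 (trace_side_ne_zero h0 hk)) (trace_le _ _)

/-- Clients of different sides are different. On a common side the count drops right after state
`k`, so the later index is strictly smaller. -/
lemma traceClient_ne (h : I.IsOrdering ℓ r) {y₀ : ℝ} (h0 : I.tab ℓ r I.total δ₀ = y₀) {k m : ℕ}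
    (hkm : k < m) (hm : m < n) : I.traceClient ℓ r δ₀ k ≠ I.traceClient ℓ r δ₀ m := by
  intro he
  have hk := trace_side_ne_zero h0 (hkm.trans hm)
  have hm' := trace_side_ne_zero h0 hm
  have hs : (I.trace ℓ r δ₀ m).2 = (I.trace ℓ r δ₀ k).2 :=
    side_unique (traceClient_mem h h0 hm) (he ▸ traceClient_mem h h0 (hkm.trans hm))
  rw [traceClient, traceClient, hs] at he
  rw [hs] at hm'
  have hle : (I.trace ℓ r δ₀ m).1 (I.trace ℓ r δ₀ k).2 ≤
      (I.trace ℓ r δ₀ (k + 1)).1 (I.trace ℓ r δ₀ k).2 := trace_antitone _ hkm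
  simp only [trace, drop_same] at hle
  have := (h.bijOn _).injOn ⟨Nat.one_le_iff_ne_zero.2 hk, trace_le k _⟩
    ⟨Nat.one_le_iff_ne_zero.2 hm', trace_le m _⟩ he
  omega

lemma traceClient_bijective (h : I.IsOrdering ℓ r) {y₀ : ℝ}
    (h0 : I.tab ℓ r I.total δ₀ = y₀) :
    Function.Bijective fun k : Fin n => I.traceClient ℓ r δ₀ k := by
  refine Finite.injective_iff_bijective.1 fun k m he => ?_
  by_contra hne
  rcases lt_or_gt_of_ne (fun e => hne (Fin.ext e) : (k : ℕ) ≠ m) with hlt | hlt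
  · exact traceClient_ne h h0 hlt m.2 he
  · exact traceClient_ne h h0 hlt k.2 he.symm

/-- Consecutive states on the traced path. -/
lemma trace_succ (hv : I.SlowClients) (h : I.IsOrdering ℓ r) {y₀ : ℝ}
    (h0 : I.tab ℓ r I.total δ₀ = y₀) {k : ℕ} (hk : k + 1 < n) :
    I.traceTime ℓ r δ₀ (k + 1) + |I.tracePos ℓ r δ₀ k - I.tracePos ℓ r δ₀ (k + 1)| ≤
        I.traceTime ℓ r δ₀ k ∧
      (I.traceTime ℓ r δ₀ k : WithTop ℝ) ≤ I.d (I.traceClient ℓ r δ₀ k) := by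
  have hk' : k < n := by omega
  have hy := tab_trace h0 hk'
  have hy' := tab_trace h0 hk
  have hne := trace_side_ne_zero h0 hk'
  have hle := trace_le (I := I) (ℓ := ℓ) (r := r) (δ₀ := δ₀) k (I.trace ℓ r δ₀ k).2
  -- In the state that precedes in time, the server has not been passed by the client that it meets
  -- next.
  have hb := (between_of_tab hv h (trace_le (k + 1)) hy').2 (I.trace ℓ r δ₀ k).2
    ((I.trace ℓ r δ₀ k).1 (I.trace ℓ r δ₀ k).2) (trace_antitone _ (Nat.le_succ k)) (by omega) hle
  have hc0 : (I.trace ℓ r δ₀ (k + 1)).1 ≠ 0 := by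
    have := (trace_finite h0 (k + 1) hk).2
    rw [Ne, counts_eq_zero_iff]; omega
  have hdrop : (drop (I.trace ℓ r δ₀ k).1 (I.trace ℓ r δ₀ k).2) = (I.trace ℓ r δ₀ (k + 1)).1 := rfl
  rw [← bump_drop hne, hdrop] at hy
  obtain ⟨y', h1, h2, h3⟩ := exists_tab_pred hc0 hy
  rw [← hdrop, drop_same, Nat.sub_add_cancel (Nat.one_le_iff_ne_zero.2 hne)] at h2 h3
  rw [hdrop] at h2
  have hyy : y' = I.traceTime ℓ r δ₀ (k + 1) := WithTop.coe_inj.1 (h1.symm.trans hy')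
  subst hyy
  refine ⟨?_, h3⟩
  set g := I.gap (I.trace ℓ r δ₀ k).2 (I.traceClient ℓ r δ₀ k) (I.traceTime ℓ r δ₀ (k + 1))
    (I.tracePos ℓ r δ₀ (k + 1)) with hg
  have h2' : I.traceTime ℓ r δ₀ k = I.traceTime ℓ r δ₀ (k + 1) + g := h2
  have hf : I.front (I.trace ℓ r δ₀ k).2 (I.traceClient ℓ r δ₀ k)
      (I.traceTime ℓ r δ₀ (k + 1) + g) = I.tracePos ℓ r δ₀ (k + 1) -
        (I.trace ℓ r δ₀ k).2.sgn * g := hb.front_add_gap hv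
  have hg0 : 0 ≤ g := gap_nonneg hv _ _ _ _
  have hp : I.tracePos ℓ r δ₀ k = I.tracePos ℓ r δ₀ (k + 1) - (I.trace ℓ r δ₀ k).2.sgn * g := by
    rw [tracePos, h2', hf]
  -- The server runs straight at unit speed, so distance and transition time agree.
  have ha : |I.tracePos ℓ r δ₀ k - I.tracePos ℓ r δ₀ (k + 1)| = g := by
    rw [hp, sub_sub_cancel_left, abs_neg, abs_mul, abs_of_nonneg hg0]
    rcases (I.trace ℓ r δ₀ k).2.sgn_eq with e | e <;> simp [e]
  rw [ha, h2']

/-- The last state of the traced path, which is the first one in time. -/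
lemma trace_last (hv : I.SlowClients) (h : I.IsOrdering ℓ r) (hfirst : I.FirstInTime ℓ r) {y₀ : ℝ}
    (h0 : I.tab ℓ r I.total δ₀ = y₀) {k : ℕ} (hk : k + 1 = n) :
    |I.tracePos ℓ r δ₀ k| ≤ I.traceTime ℓ r δ₀ k ∧
      (I.traceTime ℓ r δ₀ k : WithTop ℝ) ≤ I.d (I.traceClient ℓ r δ₀ k) := by
  have hk' : k < n := by omega
  have hy := tab_trace h0 hk'
  have hne := trace_side_ne_zero h0 hk'
  have hsum := (trace_finite h0 k hk').2
  have hle := trace_le (I := I) (ℓ := ℓ) (r := r) (δ₀ := δ₀) k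
  have hcl : I.traceClient ℓ r δ₀ k = (I.trace ℓ r δ₀ k).2.ord ℓ r
    ((I.trace ℓ r δ₀ k).1 (I.trace ℓ r δ₀ k).2) := rfl
  have hpos : I.tracePos ℓ r δ₀ k = I.front (I.trace ℓ r δ₀ k).2 (I.traceClient ℓ r δ₀ k)
    (I.traceTime ℓ r δ₀ k) := rfl
  generalize (I.trace ℓ r δ₀ k).2 = δ at *
  generalize (I.trace ℓ r δ₀ k).1 = c at *
  generalize I.traceTime ℓ r δ₀ k = y at *
  have hd := drop_add hne
  -- After `n - 1` steps back a single client is left, so this is an initial state of the table.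
  have hz : drop c δ = 0 := by rw [counts_eq_zero_iff]; omega
  have hcδ : c δ = 1 := by
    have := congrFun hz δ
    rw [drop_same] at this
    simp only [Pi.zero_apply] at this
    omega
  rw [← bump_drop hne, hz, tab_bump_zero, WithTop.coe_inj, ← gap_zero δ] at hy
  rw [hcδ] at hcl
  have hle1 : 1 ≤ (I.clients δ).card := hcδ ▸ hle δ
  have hb := (between_zero h).2 δ 1 (by simp) le_rfl hle1
  have hf := hb.front_add_gap hv
  have hg0 := gap_nonneg hv δ (δ.ord ℓ r 1) 0 0
  rw [zero_add, hy] at hf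
  rw [hy] at hg0
  constructor
  · rw [hpos, hcl, hf, zero_sub, abs_neg, abs_mul, abs_of_nonneg hg0]
    rcases δ.sgn_eq with e | e <;> simp [e]
  · rw [hcl, ← hy, gap_zero]
    cases δ
    · exact hfirst.1 hle1
    · exact hfirst.2 hle1

lemma trace_deadline (hv : I.SlowClients) (h : I.IsOrdering ℓ r) (hfirst : I.FirstInTime ℓ r)
    {y₀ : ℝ} (h0 : I.tab ℓ r I.total δ₀ = y₀) {k : ℕ} (hk : k < n) :
    (I.traceTime ℓ r δ₀ k : WithTop ℝ) ≤ I.d (I.traceClient ℓ r δ₀ k) := by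
  rcases Nat.lt_or_ge (k + 1) n with hlt | hge
  · exact (trace_succ hv h h0 hlt).2
  · exact (trace_last hv h hfirst h0 (by omega)).2

lemma traceTime_nonneg (hv : I.SlowClients) (h : I.IsOrdering ℓ r)
    {y₀ : ℝ} (h0 : I.tab ℓ r I.total δ₀ = y₀) {k : ℕ} (hk : k < n) :
    0 ≤ I.traceTime ℓ r δ₀ k :=
  (between_of_tab hv h (trace_le k) (tab_trace h0 hk)).1

/-- The trace runs backwards in time, so the clients are served in the reversed order of the trace.
-/
lemma exists_feasible_of_trace (hn : 1 ≤ n) (hτ : I.ZeroProcessing) (hr : I.DeadlinesOnly)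
    (hv : I.SlowClients) (h : I.IsOrdering ℓ r) (hfirst : I.FirstInTime ℓ r) {y₀ : ℝ}
    (h0 : I.tab ℓ r I.total δ₀ = y₀) :
    ∃ S : Solution n, I.Feasible S ∧
      S.makespan = y₀ + |I.front δ₀ (δ₀.ord ℓ r (I.total δ₀)) y₀| ∧
      ∀ k < n, S.t (I.traceClient ℓ r δ₀ k) = I.traceTime ℓ r δ₀ k ∧
        S.x (I.traceClient ℓ r δ₀ k) = I.tracePos ℓ r δ₀ k := by
  let e : Fin n ≃ Fin n := Equiv.ofBijective _ (traceClient_bijective h h0)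
  have he : ∀ k : Fin n, e k = I.traceClient ℓ r δ₀ k := fun _ => rfl
  let S : Solution n :=
    { t := fun a => I.traceTime ℓ r δ₀ (e.symm a)
      x := fun a => I.tracePos ℓ r δ₀ (e.symm a)
      tEnd := y₀ + |I.front δ₀ (δ₀.ord ℓ r (I.total δ₀)) y₀| }
  have hS : ∀ k : Fin n, S.t (e k) = I.traceTime ℓ r δ₀ k ∧ S.x (e k) = I.tracePos ℓ r δ₀ k :=
    fun k => by simp [S]
  refine ⟨S, ⟨Fin.revPerm.trans e, ?_⟩, rfl, fun k hk => hS ⟨k, hk⟩⟩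
  -- The rendezvous with number `n - k`, counted from one, is state `k` of the trace.
  have hT : ∀ k, ∀ hk : k < n, S.time (Fin.revPerm.trans e) (n - k) = I.traceTime ℓ r δ₀ k ∧
      S.position (Fin.revPerm.trans e) (n - k) = I.tracePos ℓ r δ₀ k ∧
      S.completion (Fin.revPerm.trans e) I.τ (n - k) = I.traceTime ℓ r δ₀ k := fun k hk => by
    have hkn : n - k = n - k - 1 + 1 := by omega
    have hrev : (Fin.revPerm.trans e) ⟨n - k - 1, by omega⟩ = e ⟨k, hk⟩ := by
      rw [Equiv.trans_apply]
      congr 1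
      ext
      simp [Fin.val_rev]
      omega
    have hlt : n - k - 1 < n := by omega
    rw [hkn]
    simp only [Solution.time, Solution.position, Solution.completion, hlt, dite_true, hrev, hτ _,
      add_zero, (hS ⟨k, hk⟩).1, (hS ⟨k, hk⟩).2, and_self]
  constructor
  · exact fun a => traceTime_nonneg hv h h0 (e.symm a).2
  · intro i hi1 hi2
    rcases Nat.eq_or_lt_of_le hi2 with rfl | hlt
    · have h1 := hT 0 (by omega)
      rw [Nat.sub_zero] at h1
      rw [Nat.add_sub_cancel, h1.2.2, h1.2.1]
      have e0 : I.traceTime ℓ r δ₀ 0 = y₀ := WithTop.coe_inj.1 ((tab_trace h0 hn).symm.trans h0)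
      simp only [Solution.time, Solution.position, lt_irrefl, dite_false, zero_sub, abs_neg]
      rw [tracePos, e0]
      exact le_rfl
    · have h1 := hT (n - i) (by omega)
      rw [Nat.sub_sub_self (by omega)] at h1
      rw [h1.1, h1.2.1]
      rcases Nat.eq_or_lt_of_le hi1 with rfl | hi
      · have := (trace_last hv h hfirst h0 (k := n - 1) (by omega)).1
        simpa [Solution.completion, Solution.position] using this
      · have h2 := hT (n - i + 1) (by omega)
        rw [show n - (n - i + 1) = i - 1 by omega] at h2
        rw [h2.2.1, h2.2.2]
        exact (trace_succ hv h h0 (by omega)).1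
  · intro a
    rw [hr a, zero_add, div_le_iff₀ hv.1]
    have h0t := traceTime_nonneg hv h h0 (e.symm a).2
    have ha : I.traceClient ℓ r δ₀ (e.symm a) = a := (he _).symm.trans (e.apply_symm_apply a)
    change |I.tracePos ℓ r δ₀ (e.symm a) - I.s a| ≤ I.traceTime ℓ r δ₀ (e.symm a) * I.v
    -- On its front a client has moved at full speed from time `0`, so its speed limit holds with
    -- equality.
    rw [tracePos, front_eq, ha, add_sub_cancel_left, abs_mul,
      abs_of_nonneg (mul_nonneg hv.1.le h0t), mul_comm I.v]
    rcases (I.trace ℓ r δ₀ (e.symm a)).2.sgn_eq with e' | e' <;> simp [e']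
  · intro a
    rw [hr a]
    exact traceTime_nonneg hv h h0 (e.symm a).2
  · intro a
    have ha : I.traceClient ℓ r δ₀ (e.symm a) = a := (he _).symm.trans (e.apply_symm_apply a)
    have := trace_deadline hv h hfirst h0 (e.symm a).2
    rwa [ha] at this

/-! ### The value of the dynamic program -/

variable (I ℓ r) in
/-- The time at which a server that ends with side `δ` is back at the origin. -/
noncomputable def final (δ : Side) : WithTop ℝ :=
  I.returnTime δ (δ.ord ℓ r (I.total δ)) (I.tab ℓ r I.total δ)

variable (I ℓ r) in
/-- The side of the best final state. -/
noncomputable def finalSide : Side := if I.final ℓ r .L ≤ I.final ℓ r .R then .L else .R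

lemma final_of_coe {δ : Side} {y : ℝ} (h : I.tab ℓ r I.total δ = y) :
    I.final ℓ r δ = ((y + |I.front δ (δ.ord ℓ r (I.total δ)) y| : ℝ) : WithTop ℝ) := by
  rw [final, h]
  rfl

lemma exists_of_final_eq_coe {δ : Side} {z : ℝ} (h : I.final ℓ r δ = z) :
    ∃ y : ℝ, I.tab ℓ r I.total δ = y ∧ z = y + |I.front δ (δ.ord ℓ r (I.total δ)) y| := by
  cases hy : I.tab ℓ r I.total δ with
  | top =>
    rw [final, hy] at h
    simp [returnTime] at h
  | coe y =>
    rw [final_of_coe hy, WithTop.coe_inj] at h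
    exact ⟨y, rfl, h.symm⟩

lemma final_finalSide : I.final ℓ r (I.finalSide ℓ r) = min (I.final ℓ r .L) (I.final ℓ r .R) := by
  rw [finalSide]
  split_ifs with h
  · exact (min_eq_left h).symm
  · exact (min_eq_right (le_of_not_ge h)).symm

lemma dpValue_eq (hfirst : I.FirstInTime ℓ r) :
    I.dpValue ℓ r = I.final ℓ r (I.finalSide ℓ r) := by
  rw [dpValue, if_pos hfirst, final_finalSide]
  rfl

lemma firstInTime_of_dpValue_ne_top (h : I.dpValue ℓ r ≠ ⊤) : I.FirstInTime ℓ r := by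
  by_contra hf
  exact h (by rw [dpValue, if_neg hf])

lemma dpValue_le (hn : 1 ≤ n) (hτ : I.ZeroProcessing) (hr : I.DeadlinesOnly)
    (hv : I.SlowClients) (h : I.IsOrdering ℓ r) {S : Solution n} (hS : I.Feasible S) :
    I.dpValue ℓ r ≤ (S.makespan : WithTop ℝ) := by
  obtain ⟨σ, hF⟩ := hS
  obtain ⟨δ, y, hy, hle⟩ := hF.exists_tab_le hn hτ hr hv h
  rw [dpValue_eq (hF.firstInTime hτ hr hv ℓ r), final_finalSide]
  refine le_trans ?_ ((final_of_coe hy).le.trans (WithTop.coe_le_coe.2 hle))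
  cases δ
  · exact min_le_left _ _
  · exact min_le_right _ _

/-- If the value of the dynamic program is finite, an optimal solution is read off from the traced
path. -/
lemma exists_optimal_of_trace (hn : 1 ≤ n) (hτ : I.ZeroProcessing) (hr : I.DeadlinesOnly)
    (hv : I.SlowClients) (h : I.IsOrdering ℓ r) (hfin : I.dpValue ℓ r ≠ ⊤) :
    ∃ y₀ : ℝ, I.tab ℓ r I.total (I.finalSide ℓ r) = y₀ ∧
      ∃ S : Solution n, I.Optimal S ∧ I.dpValue ℓ r = (S.makespan : WithTop ℝ) ∧
        ∀ k < n, S.t (I.traceClient ℓ r (I.finalSide ℓ r) k) =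
            I.traceTime ℓ r (I.finalSide ℓ r) k ∧
          S.x (I.traceClient ℓ r (I.finalSide ℓ r) k) = I.tracePos ℓ r (I.finalSide ℓ r) k := by
  have hfirst := firstInTime_of_dpValue_ne_top hfin
  obtain ⟨z, hz⟩ := WithTop.ne_top_iff_exists.1 hfin
  rw [dpValue_eq hfirst] at hz
  obtain ⟨y₀, hy₀, rfl⟩ := exists_of_final_eq_coe hz.symm
  obtain ⟨S, hS, hmk, hSk⟩ := exists_feasible_of_trace hn hτ hr hv h hfirst hy₀
  have hval : I.dpValue ℓ r = (S.makespan : WithTop ℝ) := by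
    rw [dpValue_eq hfirst, ← hz, hmk]
  refine ⟨y₀, hy₀, S, ⟨hS, fun S' hS' => ?_⟩, hval, hSk⟩
  have := dpValue_le hn hτ hr hv h hS'
  rw [hval] at this
  exact WithTop.coe_le_coe.1 this

lemma dpValue_eq_top (hn : 1 ≤ n) (hτ : I.ZeroProcessing) (hr : I.DeadlinesOnly)
    (hv : I.SlowClients) (h : I.IsOrdering ℓ r) (hinf : ¬ ∃ S, I.Feasible S) :
    I.dpValue ℓ r = ⊤ := by
  by_contra hfin
  obtain ⟨-, -, S, hS, -⟩ := exists_optimal_of_trace hn hτ hr hv h hfin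
  exact hinf ⟨S, hS.1⟩

lemma dpValue_ne_top (hn : 1 ≤ n) (hτ : I.ZeroProcessing) (hr : I.DeadlinesOnly)
    (hv : I.SlowClients) (h : I.IsOrdering ℓ r) (hfeas : ∃ S, I.Feasible S) :
    I.dpValue ℓ r ≠ ⊤ := by
  obtain ⟨S, hS⟩ := hfeas
  exact ne_top_of_le_ne_top WithTop.coe_ne_top (dpValue_le hn hτ hr hv h hS)

/-- The value of the dynamic program does not depend on how ties are broken. -/
lemma dpValue_congr (hn : 1 ≤ n) (hτ : I.ZeroProcessing) (hr : I.DeadlinesOnly)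
    (hv : I.SlowClients) (h : I.IsOrdering ℓ r) {ℓ' r' : ℕ → Fin n} (h' : I.IsOrdering ℓ' r') :
    I.dpValue ℓ r = I.dpValue ℓ' r' := by
  by_cases hfeas : ∃ S, I.Feasible S
  · obtain ⟨-, -, S, hS, hval, -⟩ :=
      exists_optimal_of_trace hn hτ hr hv h (dpValue_ne_top hn hτ hr hv h hfeas)
    obtain ⟨-, -, S', hS', hval', -⟩ :=
      exists_optimal_of_trace hn hτ hr hv h' (dpValue_ne_top hn hτ hr hv h' hfeas)
    rw [hval, hval', WithTop.coe_inj]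
    exact le_antisymm (hS.2 _ hS'.1) (hS'.2 _ hS.1)
  · rw [dpValue_eq_top hn hτ hr hv h hfeas, dpValue_eq_top hn hτ hr hv h' hfeas]

end Inst

end CLTSP

/-! ## The program evaluates the recursion -/

namespace RealRAM

section

variable {K : Type}

@[simp] lemma lift₁_top (f : K → K) : lift₁ f ⊤ = ⊤ := rfl

@[simp] lemma lift₁_coe (f : K → K) (a : K) : lift₁ f a = (f a : WithTop K) := rfl

@[simp] lemma lift₂_coe (f : K → K → K) (a b : K) : lift₂ f a b = (f a b : WithTop K) := rfl

@[simp] lemma lift₂_top_left (f : K → K → K) (b : WithTop K) : lift₂ f ⊤ b = ⊤ := by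
  cases b <;> rfl

@[simp] lemma lift₂_top_right (f : K → K → K) (a : WithTop K) : lift₂ f a ⊤ = ⊤ := by
  cases a <;> rfl

lemma NExp.eval_setW (m : Mem K) (x : WReg) (z : WithTop K) (e : NExp) :
    e.eval (m.setW x z) = e.eval m := by
  induction e with
  | lit _ => rfl
  | reg _ => rfl
  | get x p q hp hq => simp only [NExp.eval, hp, hq]; rfl
  | add e f he hf => simp only [NExp.eval, he, hf]
  | sub e f he hf => simp only [NExp.eval, he, hf]

/-- Induction over the iterations of a loop. -/
lemma iterate_induction {f : Mem K → Mem K} {x : NReg} {lo : ℕ} (P : ℕ → Mem K → Prop) {m : Mem K}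
    (h0 : P 0 m) (N : ℕ)
    (hstep : ∀ k < N, ∀ m', P k m' → P (k + 1) (f (m'.setN x (lo + k)))) :
    P N (iterate f x lo N m) := by
  induction N with
  | zero => exact h0
  | succ N ih =>
    exact hstep N (Nat.lt_succ_self N) _ (ih fun k hk => hstep k (Nat.lt_succ_of_lt hk))

variable [Field K] [LinearOrder K]

/-- No instruction of the program changes the part `π` of the memory. -/
def Cmd.Keeps {α : Type} (π : Mem K → α) : Cmd → Prop
  | .skip => True
  | .setN x _ => ∀ m z, π (m.setN x z) = π m
  | .setNArr x _ _ _ => ∀ m p q z, π (m.setNArr x p q z) = π m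
  | .setW x _ => ∀ m z, π (m.setW x z) = π m
  | .setWArr x _ _ _ => ∀ m p q z, π (m.setWArr x p q z) = π m
  | .seq c c' => c.Keeps π ∧ c'.Keeps π
  | .ite _ c c' => c.Keeps π ∧ c'.Keeps π
  | .forLoop x _ _ c => (∀ m z, π (m.setN x z) = π m) ∧ c.Keeps π

/-- Frame rule. `Keeps` only asks which registers and arrays occur as targets, so it is checked
without executing any code. -/
lemma Cmd.Keeps.run {α : Type} {π : Mem K → α} {c : Cmd} (h : c.Keeps π) (m : Mem K) :
    π (c.run m) = π m := by
  induction c generalizing m with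
  | skip => rfl
  | setN x e => exact h _ _
  | setNArr x p q e => exact h _ _ _ _
  | setW x e => exact h _ _
  | setWArr x p q e => exact h _ _ _ _
  | seq c c' hc hc' => exact (hc' h.2 _).trans (hc h.1 _)
  | ite b c c' hc hc' =>
    simp only [Cmd.run]
    split_ifs
    · exact hc h.1 _
    · exact hc' h.2 _
  | forLoop x lo hi c hc =>
    exact iterate_induction (fun _ m' => π m' = π m) rfl _
      fun k _ m' hm' => ((hc h.2 _).trans (h.1 _ _)).trans hm'

end

end RealRAM

namespace CLTSP

open RealRAM

variable {n : ℕ} {I : Inst n} {ℓ r : ℕ → Fin n}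

/-- The cells that hold the instance. -/
def instPart (m : Mem ℝ) :=
  (m.nreg .n, m.wreg .v, m.warr .s, m.warr .d)

/-- The cells that hold the instance and the order of the clients. -/
def sortedPart (m : Mem ℝ) :=
  (instPart m, m.nreg .nL, m.nreg .nR, m.narr .lft, m.narr .rgt)

/-- The memory contains the instance. -/
structure HasInst (I : Inst n) (m : Mem ℝ) : Prop where
  size : m.nreg .n = n
  v : m.wreg .v = (I.v : WithTop ℝ)
  s : ∀ a : Fin n, m.warr .s a 0 = (I.s a : WithTop ℝ)
  d : ∀ a : Fin n, m.warr .d a 0 = I.d a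

/-- The memory contains the instance and the order of the clients. -/
structure HasOrder (I : Inst n) (ℓ r : ℕ → Fin n) (m : Mem ℝ) : Prop extends HasInst I m where
  nL : m.nreg .nL = I.total .L
  nR : m.nreg .nR = I.total .R
  lft : ∀ i, m.narr .lft i 0 = ℓ i
  rgt : ∀ i, m.narr .rgt i 0 = r i

lemma HasInst.congr {m m' : Mem ℝ} (h : HasInst I m) (e : instPart m' = instPart m) :
    HasInst I m' := by
  simp only [instPart, Prod.mk.injEq] at e
  obtain ⟨e1, e2, e3, e4⟩ := e
  exact ⟨e1 ▸ h.size, e2 ▸ h.v, e3 ▸ h.s, e4 ▸ h.d⟩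

lemma HasOrder.congr {m m' : Mem ℝ} (h : HasOrder I ℓ r m) (e : sortedPart m' = sortedPart m) :
    HasOrder I ℓ r m' := by
  simp only [sortedPart, Prod.mk.injEq] at e
  obtain ⟨e0, e1, e2, e3, e4⟩ := e
  exact ⟨h.toHasInst.congr e0, e1 ▸ h.nL, e2 ▸ h.nR, e3 ▸ h.lft, e4 ▸ h.rgt⟩

lemma HasInst.eval_sOf {m : Mem ℝ} (h : HasInst I m) {e : NExp} {a : Fin n}
    (ha : e.eval m = a) : (sOf e).eval m = (I.s a : WithTop ℝ) := by
  simp only [sOf, WExp.eval, NExp.eval, ha, h.s]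

lemma HasInst.eval_dOf {m : Mem ℝ} (h : HasInst I m) {e : NExp} {a : Fin n}
    (ha : e.eval m = a) : (dOf e).eval m = I.d a := by
  simp only [dOf, WExp.eval, NExp.eval, ha, h.d]

lemma HasInst.eval_frontExp {m : Mem ℝ} (h : HasInst I m) {e : NExp} {a : Fin n}
    (ha : e.eval m = a) (δ : Side) {w : WExp} {y : ℝ} (hw : w.eval m = y) :
    (frontExp δ e w).eval m = (I.front δ a y : WithTop ℝ) := by
  cases δ <;>
    simp only [frontExp, WExp.eval, h.eval_sOf ha, hw, h.v, Inst.front, lift₂_coe]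

lemma eval_frontExp_top {m : Mem ℝ} (e : NExp) (δ : Side) {w : WExp} (hw : w.eval m = ⊤) :
    (frontExp δ e w).eval m = ⊤ := by
  cases δ <;> simp [frontExp, WExp.eval, hw]

lemma HasInst.eval_firstExp {m : Mem ℝ} (h : HasInst I m) {e : NExp} {a : Fin n}
    (ha : e.eval m = a) :
    (firstExp e).eval m = ((|I.s a| / (1 + I.v) : ℝ) : WithTop ℝ) := by
  simp only [firstExp, WExp.eval, h.eval_sOf ha, h.v, lift₁_coe, lift₂_coe]

lemma HasInst.setN {m : Mem ℝ} (h : HasInst I m) {x : NReg} (hx : x ≠ .n) (z : ℕ) :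
    HasInst I (m.setN x z) := by
  refine h.congr ?_
  simp [instPart, Mem.setN, hx.symm]

lemma HasInst.setW {m : Mem ℝ} (h : HasInst I m) {x : WReg} (hx : x ≠ .v) (z : WithTop ℝ) :
    HasInst I (m.setW x z) := by
  refine h.congr ?_
  simp [instPart, Mem.setW, hx.symm]

/-! ### The cells of the table -/

/-- The final content of `gap` is left open: it is a temporary value, and it is `⊤` when `D` is. -/
lemma run_relaxCmd {m : Mem ℝ} (h : HasInst I m) {e : WExp} {D : WithTop ℝ} (he : e.eval m = D)
    {δ' δ : Side} {e' : NExp} {a' a : Fin n} (ha' : e'.eval m = a') (ha : m.nreg .a = a)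
    (c : WReg) :
    ∃ g, (relaxCmd c e δ' e' δ).run m =
      ((m.setW .y D).setW .gap g).setW c (D + I.transition δ' a' δ a D) := by
  have h1 : HasInst I (m.setW .y D) := h.setW (by decide) _
  have e1 : e'.eval (m.setW .y D) = a' := (NExp.eval_setW _ _ _ _).trans ha'
  have ea : NExp.eval (m.setW .y D) (.reg .a) = a := ha
  have ey : WExp.eval (m.setW .y D) (.reg .y) = D := by simp [WExp.eval, Mem.setW]
  cases D with
  -- Arithmetic is strict, so both outcomes of the deadline test store `⊤`.
  | top =>
    refine ⟨⊤, ?_⟩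
    simp only [relaxCmd, Cmd.block, Cmd.run, he]
    have eg : WExp.eval (m.setW .y ⊤) (.div (.abs (.sub (frontExp δ' e' (.reg .y))
        (frontExp δ (.reg .a) (.reg .y)))) (.add .one (.reg .v))) = ⊤ := by
      simp [WExp.eval, eval_frontExp_top e' δ' ey]
    rw [eg]
    simp [WExp.eval, Mem.setW]
  | coe y =>
    refine ⟨I.gap δ a y (I.front δ' a' y), ?_⟩
    simp only [relaxCmd, Cmd.block, Cmd.run, he]
    have eg : WExp.eval (m.setW .y y) (.div (.abs (.sub (frontExp δ' e' (.reg .y))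
        (frontExp δ (.reg .a) (.reg .y)))) (.add .one (.reg .v))) =
        (I.gap δ a y (I.front δ' a' y) : WithTop ℝ) := by
      simp only [WExp.eval, h1.eval_frontExp e1 δ' ey, h1.eval_frontExp ea δ ey, h1.v, Inst.gap,
        lift₁_coe, lift₂_coe]
    rw [eg]
    set m2 := (m.setW .y y).setW .gap (I.gap δ a y (I.front δ' a' y))
    have h2 : HasInst I m2 := h1.setW (by decide) _
    have ed : WExp.eval m2 (dOf (.reg .a)) = I.d a := h2.eval_dOf ha
    have es : WExp.eval m2 (.add (.reg .y) (.reg .gap)) =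
        ((y + I.gap δ a y (I.front δ' a' y) : ℝ) : WithTop ℝ) := by
      simp [WExp.eval, m2, Mem.setW]
    rw [Inst.transition_coe]
    simp only [BExp.eval, ed, es, decide_eq_true_eq]
    split_ifs with hle
    · rw [WithTop.coe_add]
    · simp [WExp.eval]

/-- The pair of numbers `(i, j)` as a function of the side. -/
def counts (i j : ℕ) : Side → ℕ
  | .L => i
  | .R => j

@[simp] lemma counts_L (i j : ℕ) : counts i j .L = i := rfl

@[simp] lemma counts_R (i j : ℕ) : counts i j .R = j := rfl

lemma counts_eta (c : Side → ℕ) : counts (c .L) (c .R) = c := by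
  funext δ; cases δ <;> rfl

lemma bump_counts_L (i j : ℕ) : bump (counts i j) .L = counts (i + 1) j := by
  funext δ; cases δ <;> simp [bump]

lemma bump_counts_R (i j : ℕ) : bump (counts i j) .R = counts i (j + 1) := by
  funext δ; cases δ <;> simp [bump]

/-- The number that the program uses for a side. -/
def Side.code : Side → ℕ
  | .L => 0
  | .R => 1

/-- The array that holds the table. -/
def Side.valArr : Side → WArr
  | .L => .DL
  | .R => .DR

/-- The array that holds the sides of the best preceding states. -/
def Side.predArr : Side → NArr
  | .L => .predL
  | .R => .predR

/-- A cell of the table has been computed. -/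
def CellDone (I : Inst n) (ℓ r : ℕ → Fin n) (m : Mem ℝ) (i j : ℕ) (δ : Side) : Prop :=
  m.warr δ.valArr i j = I.tab ℓ r (counts i j) δ ∧
    (counts i j δ ≠ 0 → drop (counts i j) δ ≠ 0 →
      m.narr δ.predArr i j = (I.predSide ℓ r (drop (counts i j) δ) δ).code)

/-- Matches the comparison made by the program with the recursion. Both prefer `L` in case of a tie,
so the stored code is that of `predSide`. -/
lemma min_cand_and_code (c : Side → ℕ) (hc : c ≠ 0) (δ : Side) :
    (I.cand ℓ r c δ .L ≤ I.cand ℓ r c δ .R →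
      I.tab ℓ r (bump c δ) δ = I.cand ℓ r c δ .L ∧ (I.predSide ℓ r c δ).code = 0) ∧
    (¬ I.cand ℓ r c δ .L ≤ I.cand ℓ r c δ .R →
      I.tab ℓ r (bump c δ) δ = I.cand ℓ r c δ .R ∧ (I.predSide ℓ r c δ).code = 1) := by
  refine ⟨fun h => ?_, fun h => ?_⟩ <;>
  · rw [Inst.tab_bump_eq_cand I ℓ r hc]
    simp [Inst.predSide, h, Side.code]

lemma counts_ne_zero {i j : ℕ} (h : ¬ (i = 0 ∧ j = 0)) : counts i j ≠ 0 := by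
  rw [Ne, counts_eq_zero_iff]
  simp only [counts_L, counts_R]
  omega

/-- Compute a cell of the table from the two cells with indices `ei` and `ej`. -/
def bestCmd (δ : Side) (ea ei ej : NExp) : Cmd :=
  .block [
    .setN .a ea,
    relaxCmd .c₁ (.get .DL ei ej) .L (lftAt ei) δ,
    relaxCmd .c₂ (.get .DR ei ej) .R (rgtAt ej) δ,
    .ite (.wordLe (.reg .c₁) (.reg .c₂))
      (.block [.setWArr δ.valArr (.reg .i) (.reg .j) (.reg .c₁),
        .setNArr δ.predArr (.reg .i) (.reg .j) (.lit 0)])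
      (.block [.setWArr δ.valArr (.reg .i) (.reg .j) (.reg .c₂),
        .setNArr δ.predArr (.reg .i) (.reg .j) (.lit 1)])]

/-- The cell `(i, j)` of side `δ` is the only one in which the memories `m` and `m'` differ. -/
def SameCells (δ : Side) (i j : ℕ) (m m' : Mem ℝ) : Prop :=
  ∀ p q, (p, q) ≠ (i, j) → m'.warr δ.valArr p q = m.warr δ.valArr p q ∧
    m'.narr δ.predArr p q = m.narr δ.predArr p q

/-- One computation serves both sides, which differ in the index that is decreased. The index
expressions are evaluated again after temporary registers have changed; hence `hei` and `hej` speak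
of all memories with the right loop counter. -/
lemma run_bestCmd {m : Mem ℝ} (h : HasOrder I ℓ r m) {i j : ℕ} (hi : m.nreg .i = i)
    (hj : m.nreg .j = j) {c : Side → ℕ} (hc : c ≠ 0) {δ : Side} (hb : bump c δ = counts i j)
    {ea ei ej : NExp} (hea : ea.eval m = δ.ord ℓ r (c δ + 1))
    (hei : ∀ m' : Mem ℝ, m'.nreg .i = i → ei.eval m' = c .L)
    (hej : ∀ m' : Mem ℝ, m'.nreg .j = j → ej.eval m' = c .R)
    (hp : ∀ δ : Side, m.warr δ.valArr (c .L) (c .R) = I.tab ℓ r c δ) :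
    CellDone I ℓ r ((bestCmd δ ea ei ej).run m) i j δ ∧
      SameCells δ i j m ((bestCmd δ ea ei ej).run m) := by
  obtain ⟨m1, hm1⟩ : ∃ m1, m1 = m.setN .a (δ.ord ℓ r (c δ + 1)) := ⟨_, rfl⟩
  have h1i : HasInst I m1 := hm1 ▸ h.toHasInst.setN (by decide) _
  have h1r : m1.nreg .i = i ∧ m1.nreg .j = j := by simp [hm1, Mem.setN, hi, hj]
  have h1w : m1.warr = m.warr ∧ m1.narr = m.narr := by simp [hm1, Mem.setN]
  have h1a : m1.nreg .a = δ.ord ℓ r (c δ + 1) := by simp [hm1, Mem.setN]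
  obtain ⟨g1, hg1⟩ := run_relaxCmd h1i (e := .get .DL ei ej) (D := I.tab ℓ r c .L)
    (by simp only [WExp.eval, hei m1 h1r.1, hej m1 h1r.2, h1w.1]; exact hp .L)
    (δ' := .L) (δ := δ) (e' := lftAt ei) (a' := ℓ (c .L))
    (by simp only [lftAt, NExp.eval, hei m1 h1r.1, h1w.2, h.lft]) h1a .c₁
  obtain ⟨m2, hm2⟩ : ∃ m2, m2 = (relaxCmd .c₁ (.get .DL ei ej) .L (lftAt ei) δ).run m1 := ⟨_, rfl⟩
  rw [← hm2] at hg1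
  have h2i : HasInst I m2 := by
    rw [hg1]
    exact ((h1i.setW (by decide) _).setW (by decide) _).setW (by decide) _
  have h2r : m2.nreg = m1.nreg := by rw [hg1]; rfl
  have h2w : m2.warr = m.warr ∧ m2.narr = m.narr := by rw [hg1]; exact h1w
  obtain ⟨g2, hg2⟩ := run_relaxCmd h2i (e := .get .DR ei ej) (D := I.tab ℓ r c .R)
    (by simp only [WExp.eval, hei m2 (h2r ▸ h1r.1), hej m2 (h2r ▸ h1r.2), h2w.1]; exact hp .R)
    (δ' := .R) (δ := δ) (e' := rgtAt ej) (a' := r (c .R))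
    (by simp only [rgtAt, NExp.eval, hej m2 (h2r ▸ h1r.2), h2w.2, h.rgt]) (h2r ▸ h1a) .c₂
  obtain ⟨m3, hm3⟩ : ∃ m3, m3 = (relaxCmd .c₂ (.get .DR ei ej) .R (rgtAt ej) δ).run m2 := ⟨_, rfl⟩
  rw [← hm3] at hg2
  have h3r : m3.nreg .i = i ∧ m3.nreg .j = j := by rw [hg2]; exact h2r ▸ h1r
  have h3w : m3.warr = m.warr ∧ m3.narr = m.narr := by rw [hg2]; exact h2w
  have ec1 : m3.wreg .c₁ = I.cand ℓ r c δ .L := by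
    rw [hg2, hg1]; simp [Mem.setW]; rfl
  have ec2 : m3.wreg .c₂ = I.cand ℓ r c δ .R := by
    rw [hg2]; simp [Mem.setW]; rfl
  have e : (bestCmd δ ea ei ej).run m = if I.cand ℓ r c δ .L ≤ I.cand ℓ r c δ .R then
      (m3.setWArr δ.valArr i j (I.cand ℓ r c δ .L)).setNArr δ.predArr i j 0 else
      (m3.setWArr δ.valArr i j (I.cand ℓ r c δ .R)).setNArr δ.predArr i j 1 := by
    simp only [bestCmd, Cmd.block, Cmd.run, BExp.eval, NExp.eval, WExp.eval, hea, ← hm1, ← hm2,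
      ← hm3, h3r.1, h3r.2, Mem.setWArr, ec1, ec2, decide_eq_true_eq]
  have hmin := min_cand_and_code (I := I) (ℓ := ℓ) (r := r) c hc δ
  have hdrop : drop (bump c δ) δ = c := by simp [bump, drop]
  rw [e, CellDone, SameCells, ← hb, hdrop]
  split_ifs with hle
  · have := hmin.1 hle
    refine ⟨⟨?_, fun _ _ => ?_⟩, fun p q hpq => ?_⟩
    · simp [Mem.setWArr, Mem.setNArr, this.1]
    · simp [Mem.setWArr, Mem.setNArr, this.2]
    · rw [ne_eq, Prod.mk.injEq] at hpq
      simp [Mem.setWArr, Mem.setNArr, hpq, h3w]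
  · have := hmin.2 hle
    refine ⟨⟨?_, fun _ _ => ?_⟩, fun p q hpq => ?_⟩
    · simp [Mem.setWArr, Mem.setNArr, this.1]
    · simp [Mem.setWArr, Mem.setNArr, this.2]
    · rw [ne_eq, Prod.mk.injEq] at hpq
      simp [Mem.setWArr, Mem.setNArr, hpq, h3w]

lemma cellDone_zero {m : Mem ℝ} {i j : ℕ} {δ : Side} (h0 : counts i j δ = 0) :
    CellDone I ℓ r (m.setWArr δ.valArr i j ⊤) i j δ ∧
      SameCells δ i j m (m.setWArr δ.valArr i j ⊤) := by
  refine ⟨⟨?_, fun h => absurd h0 h⟩, fun p q hpq => ?_⟩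
  · rw [Inst.tab_eq_top _ _ _ h0]
    simp [Mem.setWArr]
  · rw [ne_eq, Prod.mk.injEq] at hpq
    simp [Mem.setWArr, hpq]

lemma cellDone_one {m : Mem ℝ} {i j : ℕ} {δ : Side} (h1 : bump 0 δ = counts i j) :
    CellDone I ℓ r
        (m.setWArr δ.valArr i j ((|I.s (δ.ord ℓ r 1)| / (1 + I.v) : ℝ) : WithTop ℝ)) i j δ ∧
      SameCells δ i j m
        (m.setWArr δ.valArr i j ((|I.s (δ.ord ℓ r 1)| / (1 + I.v) : ℝ) : WithTop ℝ)) := by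
  refine ⟨⟨?_, fun _ h => absurd ?_ h⟩, fun p q hpq => ?_⟩
  · rw [← h1, Inst.tab_bump_zero]
    simp [Mem.setWArr]
  · rw [← h1]
    simp [bump, drop]
  · rw [ne_eq, Prod.mk.injEq] at hpq
    simp [Mem.setWArr, hpq]

lemma counts_zero : counts 0 0 = 0 := counts_eta 0

lemma run_cellLCmd {m : Mem ℝ} (h : HasOrder I ℓ r m) {i j : ℕ} (hi : m.nreg .i = i)
    (hj : m.nreg .j = j)
    (hp : ∀ δ : Side, i ≠ 0 → m.warr δ.valArr (i - 1) j = I.tab ℓ r (counts (i - 1) j) δ) :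
    CellDone I ℓ r (cellLCmd.run m) i j .L ∧ SameCells .L i j m (cellLCmd.run m) := by
  rcases Nat.eq_zero_or_pos i with h0 | hpos
  · have e : cellLCmd.run m = m.setWArr .DL i j ⊤ := by
      simp [cellLCmd, Cmd.run, BExp.eval, NExp.eval, WExp.eval, hi, hj, h0]
    rw [e]
    exact cellDone_zero (δ := .L) h0
  by_cases h1 : i = 1 ∧ j = 0
  · have e : cellLCmd.run m =
        m.setWArr .DL i j ((|I.s (ℓ 1)| / (1 + I.v) : ℝ) : WithTop ℝ) := by
      have ef : (firstExp (lftAt (.lit 1))).eval m = _ :=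
        h.eval_firstExp (a := ℓ 1) (by simp [lftAt, NExp.eval, h.lft])
      simp only [cellLCmd, Cmd.run, BExp.eval, NExp.eval, hi, hj, ef]
      simp [h1]
    rw [e]
    exact cellDone_one (δ := .L) (by rw [← counts_zero, bump_counts_L, h1.1, h1.2])
  · have hne : i ≠ 0 := by omega
    have e : cellLCmd.run m =
        (bestCmd .L (lftAt (.reg .i)) (.sub (.reg .i) (.lit 1)) (.reg .j)).run m := by
      rw [cellLCmd, Cmd.run, if_neg (by simp [BExp.eval, NExp.eval, hi, hne]), Cmd.run,
        if_neg (by simpa [BExp.eval, NExp.eval, hi, hj] using h1)]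
      rfl
    rw [e]
    have h1' : i - 1 + 1 = i := by omega
    refine run_bestCmd h hi hj (c := counts (i - 1) j) (counts_ne_zero (by omega))
      (by rw [bump_counts_L, h1']) ?_ ?_ ?_ fun δ => hp δ hne
    · simp [lftAt, NExp.eval, hi, h.lft, h1', Side.ord]
    · intro m' hm'
      simp [NExp.eval, hm']
    · intro m' hm'
      simp [NExp.eval, hm']

lemma run_cellRCmd {m : Mem ℝ} (h : HasOrder I ℓ r m) {i j : ℕ} (hi : m.nreg .i = i)
    (hj : m.nreg .j = j)
    (hp : ∀ δ : Side, j ≠ 0 → m.warr δ.valArr i (j - 1) = I.tab ℓ r (counts i (j - 1)) δ) :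
    CellDone I ℓ r (cellRCmd.run m) i j .R ∧ SameCells .R i j m (cellRCmd.run m) := by
  rcases Nat.eq_zero_or_pos j with h0 | hpos
  · have e : cellRCmd.run m = m.setWArr .DR i j ⊤ := by
      simp [cellRCmd, Cmd.run, BExp.eval, NExp.eval, WExp.eval, hi, hj, h0]
    rw [e]
    exact cellDone_zero (δ := .R) h0
  by_cases h1 : i = 0 ∧ j = 1
  · have e : cellRCmd.run m =
        m.setWArr .DR i j ((|I.s (r 1)| / (1 + I.v) : ℝ) : WithTop ℝ) := by
      have ef : (firstExp (rgtAt (.lit 1))).eval m = _ :=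
        h.eval_firstExp (a := r 1) (by simp [rgtAt, NExp.eval, h.rgt])
      simp only [cellRCmd, Cmd.run, BExp.eval, NExp.eval, hi, hj, ef]
      simp [h1]
    rw [e]
    exact cellDone_one (δ := .R) (by rw [← counts_zero, bump_counts_R, h1.1, h1.2])
  · have hne : j ≠ 0 := by omega
    have e : cellRCmd.run m =
        (bestCmd .R (rgtAt (.reg .j)) (.reg .i) (.sub (.reg .j) (.lit 1))).run m := by
      rw [cellRCmd, Cmd.run, if_neg (by simp [BExp.eval, NExp.eval, hj, hne]), Cmd.run,
        if_neg (by simpa [BExp.eval, NExp.eval, hi, hj] using h1)]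
      rfl
    rw [e]
    have h1' : j - 1 + 1 = j := by omega
    refine run_bestCmd h hi hj (c := counts i (j - 1)) (counts_ne_zero (by omega))
      (by rw [bump_counts_R, h1']) ?_ ?_ ?_ fun δ => hp δ hne
    · simp [rgtAt, NExp.eval, hj, h.rgt, h1', Side.ord]
    · intro m' hm'
      simp [NExp.eval, hm']
    · intro m' hm'
      simp [NExp.eval, hm']

/-! ### The table -/

lemma CellDone.congr {m m' : Mem ℝ} {i j : ℕ} {δ : Side} (h : CellDone I ℓ r m i j δ)
    (hw : m'.warr δ.valArr i j = m.warr δ.valArr i j)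
    (hn : m'.narr δ.predArr i j = m.narr δ.predArr i j) : CellDone I ℓ r m' i j δ := by
  rw [CellDone, hw, hn]
  exact h

/-- The part of the memory that the computation of a cell of side `δ` does not change. -/
def cellFrame (δ : Side) (m : Mem ℝ) :=
  (sortedPart m, m.nreg .i, m.nreg .j, m.nreg .ok, m.warr δ.valArr, m.narr δ.predArr)

lemma cellLCmd_keeps : cellLCmd.Keeps (cellFrame .R) := by
  simp [Cmd.Keeps, cellLCmd, relaxCmd, Cmd.block, cellFrame, sortedPart, instPart, Mem.setN,
    Mem.setW, Mem.setWArr, Mem.setNArr, Side.valArr, Side.predArr]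

lemma cellRCmd_keeps : cellRCmd.Keeps (cellFrame .L) := by
  simp [Cmd.Keeps, cellRCmd, relaxCmd, Cmd.block, cellFrame, sortedPart, instPart, Mem.setN,
    Mem.setW, Mem.setWArr, Mem.setNArr, Side.valArr, Side.predArr]

lemma HasOrder.setN {m : Mem ℝ} (h : HasOrder I ℓ r m) {x : NReg} (hx : x ≠ .n) (hL : x ≠ .nL)
    (hR : x ≠ .nR) (z : ℕ) : HasOrder I ℓ r (m.setN x z) := by
  refine h.congr ?_
  simp [sortedPart, instPart, Mem.setN, hx.symm, hL.symm, hR.symm]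

lemma run_cellCmds {m : Mem ℝ} (h : HasOrder I ℓ r m) {i j : ℕ} (hi : m.nreg .i = i)
    (hj : m.nreg .j = j) (hprev : ∀ p q δ, p < i ∧ q ≤ j ∨ p = i ∧ q < j → CellDone I ℓ r m p q δ)
    {m' : Mem ℝ} (hm' : m' = (Cmd.block [cellLCmd, cellRCmd]).run m) :
    HasOrder I ℓ r m' ∧ m'.nreg .i = i ∧ m'.nreg .ok = m.nreg .ok ∧
      (∀ δ, CellDone I ℓ r m' i j δ) ∧ ∀ p q δ, (p, q) ≠ (i, j) → CellDone I ℓ r m p q δ →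
        CellDone I ℓ r m' p q δ := by
  simp only [Cmd.block, Cmd.run] at hm'
  obtain ⟨hL, hL'⟩ := run_cellLCmd h hi hj fun δ hne =>
    (hprev (i - 1) j δ (Or.inl ⟨by omega, le_rfl⟩)).1
  have fL := cellLCmd_keeps.run m
  generalize cellLCmd.run m = m1 at *
  simp only [cellFrame, Prod.mk.injEq] at fL
  obtain ⟨fL0, fLi, fLj, fLok, fLw, fLn⟩ := fL
  have keepL : ∀ p q δ, (p, q) ≠ (i, j) → CellDone I ℓ r m p q δ → CellDone I ℓ r m1 p q δ := by
    intro p q δ hpq hd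
    cases δ
    · exact hd.congr (hL' p q hpq).1 (hL' p q hpq).2
    · exact hd.congr (by rw [fLw]) (by rw [fLn])
  have h1 := h.congr fL0
  -- The `R` cell reads the entries at `(i, j - 1)`, which the preceding computation at `(i, j)` has
  -- left intact.
  obtain ⟨hR, hR'⟩ := run_cellRCmd h1 (fLi.trans hi) (fLj.trans hj) fun δ hne =>
    (keepL i (j - 1) δ (by simp; omega) (hprev i (j - 1) δ (Or.inr ⟨rfl, by omega⟩))).1
  have fR := cellRCmd_keeps.run m1
  rw [← hm'] at fR hR hR'
  simp only [cellFrame, Prod.mk.injEq] at fR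
  obtain ⟨fR0, fRi, fRj, fRok, fRw, fRn⟩ := fR
  refine ⟨h1.congr fR0, fRi.trans (fLi.trans hi), fRok.trans fLok, fun δ => ?_,
    fun p q δ hpq hd => ?_⟩
  · cases δ
    · exact hL.congr (by rw [fRw]) (by rw [fRn])
    · exact hR
  · have := keepL p q δ hpq hd
    cases δ
    · exact this.congr (by rw [fRw]) (by rw [fRn])
    · exact this.congr (hR' p q hpq).1 (hR' p q hpq).2

/-- The invariant of the nested loops is that all lexicographically smaller cells are done; every
cell depends only on such cells. -/
lemma run_tableCmd {m : Mem ℝ} (h : HasOrder I ℓ r m) :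
    HasOrder I ℓ r (tableCmd.run m) ∧ (tableCmd.run m).nreg .ok = m.nreg .ok ∧
      ∀ i j δ, i ≤ I.total .L → j ≤ I.total .R → CellDone I ℓ r (tableCmd.run m) i j δ := by
  have key := iterate_induction
    (f := (Cmd.forLoop .j (.lit 0) (.add (.reg .nR) (.lit 1)) (.block [cellLCmd, cellRCmd])).run)
    (x := .i) (lo := 0) (m := m)
    (fun i m' => HasOrder I ℓ r m' ∧ m'.nreg .ok = m.nreg .ok ∧
      ∀ p q δ, p < i → q ≤ I.total .R → CellDone I ℓ r m' p q δ)
    ⟨h, rfl, fun p q δ hp => absurd hp (Nat.not_lt_zero _)⟩ (I.total .L + 1)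
    (by
      rintro i - m1 ⟨h1, hok, hdone⟩
      have e : (m1.setN .i (0 + i)).nreg .nR = I.total .R := by simp [Mem.setN, h1.nR]
      simp only [Cmd.run, NExp.eval, e, Nat.sub_zero]
      have inner := iterate_induction (f := (Cmd.block [cellLCmd, cellRCmd]).run)
        (x := .j) (lo := 0) (m := m1.setN .i (0 + i))
        (fun j m' => HasOrder I ℓ r m' ∧ m'.nreg .i = i ∧ m'.nreg .ok = m.nreg .ok ∧
          ∀ p q δ, p < i ∧ q ≤ I.total .R ∨ p = i ∧ q < j → CellDone I ℓ r m' p q δ)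
        ⟨h1.setN (by decide) (by decide) (by decide) _, by simp [Mem.setN],
          by simp [Mem.setN, hok], fun p q δ hpq => by
            rcases hpq with hpq | hpq
            · exact (hdone p q δ hpq.1 hpq.2).congr rfl rfl
            · omega⟩
        (I.total .R + 1)
        (by
          rintro j hj m2 ⟨h2, hi, hok2, hdone2⟩
          obtain ⟨g1, g2, g3, g4, g5⟩ := run_cellCmds (i := i) (j := j)
            (h2.setN (x := .j) (by decide) (by decide) (by decide) (0 + j))
            (by simp [Mem.setN, hi]) (by simp [Mem.setN])
            (fun p q δ hpq => (hdone2 p q δ (by omega)).congr rfl rfl) rfl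
          refine ⟨g1, g2, g3.trans (by simp [Mem.setN, hok2]), fun p q δ hpq => ?_⟩
          by_cases hij : (p, q) = (i, j)
          · rw [Prod.mk.injEq] at hij
            rw [hij.1, hij.2]
            exact g4 δ
          · refine g5 p q δ hij ((hdone2 p q δ ?_).congr rfl rfl)
            rw [Prod.mk.injEq] at hij
            omega)
      refine ⟨inner.1, inner.2.2.1, fun p q δ hp hq => inner.2.2.2 p q δ ?_⟩
      omega)
  have e : tableCmd.run m = iterate (Cmd.forLoop .j (.lit 0) (.add (.reg .nR) (.lit 1))
      (.block [cellLCmd, cellRCmd])).run .i 0 (I.total .L + 1) m := by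
    rw [tableCmd, Cmd.run]
    simp only [NExp.eval, h.nL, Nat.sub_zero]
  rw [e]
  exact ⟨key.1, key.2.1, fun i j δ hi hj => key.2.2 i j δ (by omega) hj⟩

end CLTSP

/-! ### Execution of single instructions -/

namespace RealRAM

section

variable {K : Type} [Field K] [LinearOrder K] (m : Mem K)

lemma run_block_cons (c c' : Cmd) (cs : List Cmd) :
    (Cmd.block (c :: c' :: cs)).run m = (Cmd.block (c' :: cs)).run (c.run m) := rfl

lemma run_block_one (c : Cmd) : (Cmd.block [c]).run m = c.run m := rfl

variable {m}

lemma run_setN {x : NReg} {e : NExp} {z : ℕ} (h : e.eval m = z) :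
    (Cmd.setN x e).run m = m.setN x z := by rw [Cmd.run, h]

lemma run_setW {x : WReg} {e : WExp} {z : WithTop K} (h : e.eval m = z) :
    (Cmd.setW x e).run m = m.setW x z := by rw [Cmd.run, h]

lemma run_setWArr {x : WArr} {ep eq : NExp} {e : WExp} {p q : ℕ} {z : WithTop K}
    (hp : ep.eval m = p) (hq : eq.eval m = q) (h : e.eval m = z) :
    (Cmd.setWArr x ep eq e).run m = m.setWArr x p q z := by rw [Cmd.run, hp, hq, h]

lemma run_ite_pos {b : BExp} {c c' : Cmd} (h : b.eval m = true) :
    (Cmd.ite b c c').run m = c.run m := by rw [Cmd.run, if_pos h]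

lemma run_ite_neg {b : BExp} {c c' : Cmd} (h : ¬ b.eval m = true) :
    (Cmd.ite b c c').run m = c'.run m := by rw [Cmd.run, if_neg h]

end

end RealRAM

namespace CLTSP

open RealRAM

variable {n : ℕ} {I : Inst n} {ℓ r : ℕ → Fin n}

/-! ### The check of the first deadlines -/

lemma checkCmd_keeps : checkCmd.Keeps sortedPart := by
  simp [Cmd.Keeps, checkCmd, Cmd.block, sortedPart, instPart, Mem.setN]

lemma run_checkCmd {m : Mem ℝ} (h : HasOrder I ℓ r m) :
    HasOrder I ℓ r (checkCmd.run m) ∧ ((checkCmd.run m).nreg .ok = 0 ↔ ¬ I.FirstInTime ℓ r) := by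
  refine ⟨h.congr (checkCmd_keeps.run m), ?_⟩
  have key : ∀ z, HasOrder I ℓ r (m.setN .ok z) := fun z =>
    h.setN (by decide) (by decide) (by decide) z
  have eL : ∀ z, (firstExp (lftAt (.lit 1))).eval (m.setN .ok z) =
      ((|I.s (ℓ 1)| / (1 + I.v) : ℝ) : WithTop ℝ) := fun z =>
    (key z).eval_firstExp (by simp [lftAt, NExp.eval, (key z).lft])
  have eR : ∀ z, (firstExp (rgtAt (.lit 1))).eval (m.setN .ok z) =
      ((|I.s (r 1)| / (1 + I.v) : ℝ) : WithTop ℝ) := fun z =>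
    (key z).eval_firstExp (by simp [rgtAt, NExp.eval, (key z).rgt])
  have dL : ∀ z, (dOf (lftAt (.lit 1))).eval (m.setN .ok z) = I.d (ℓ 1) := fun z =>
    (key z).eval_dOf (by simp [lftAt, NExp.eval, (key z).lft])
  have dR : ∀ z, (dOf (rgtAt (.lit 1))).eval (m.setN .ok z) = I.d (r 1) := fun z =>
    (key z).eval_dOf (by simp [rgtAt, NExp.eval, (key z).rgt])
  have ss : ∀ z z', (m.setN .ok z).setN .ok z' = m.setN .ok z' := fun z z' => by
    simp only [Mem.setN, Mem.mk.injEq, and_true]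
    funext x
    split_ifs <;> rfl
  have nL : ∀ z, (m.setN .ok z).nreg .nL = I.left.card := fun z => (key z).nL
  have nR : ∀ z, (m.setN .ok z).nreg .nR = I.right.card := fun z => (key z).nR
  have eo : ∀ z, (m.setN .ok z).nreg .ok = z := fun z => by simp [Mem.setN]
  rw [checkCmd, run_block_cons, run_setN (z := 1) rfl, run_block_cons, run_block_one]
  by_cases h1 : 1 ≤ I.left.card → ((|I.s (ℓ 1)| / (1 + I.v) : ℝ) : WithTop ℝ) ≤ I.d (ℓ 1)
  · rw [run_ite_neg (m := m.setN .ok 1) (by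
      simp only [BExp.eval, NExp.eval, nL, eL, dL, Bool.and_eq_true, Bool.not_eq_true',
        decide_eq_true_eq, decide_eq_false_iff_not]
      exact fun h' => h'.2 (h1 h'.1)), Cmd.run]
    by_cases h2 : 1 ≤ I.right.card → ((|I.s (r 1)| / (1 + I.v) : ℝ) : WithTop ℝ) ≤ I.d (r 1)
    · rw [run_ite_neg (m := m.setN .ok 1) (by
        simp only [BExp.eval, NExp.eval, nR, eR, dR, Bool.and_eq_true, Bool.not_eq_true',
          decide_eq_true_eq, decide_eq_false_iff_not]
        exact fun h' => h'.2 (h2 h'.1)), Cmd.run, eo]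
      have : I.FirstInTime ℓ r := ⟨h1, h2⟩
      simp [this]
    · rw [run_ite_pos (m := m.setN .ok 1) (by
        simp only [BExp.eval, NExp.eval, nR, eR, dR, Bool.and_eq_true, Bool.not_eq_true',
          decide_eq_true_eq, decide_eq_false_iff_not]
        exact Classical.not_imp.1 h2), run_setN (z := 0) rfl, ss, eo]
      have : ¬ I.FirstInTime ℓ r := fun h' => h2 h'.2
      simp [this]
  · rw [run_ite_pos (m := m.setN .ok 1) (by
      simp only [BExp.eval, NExp.eval, nL, eL, dL, Bool.and_eq_true, Bool.not_eq_true',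
        decide_eq_true_eq, decide_eq_false_iff_not]
      exact Classical.not_imp.1 h1), run_setN (z := 0) rfl, ss]
    have : ¬ I.FirstInTime ℓ r := fun h' => h1 h'.1
    -- The flag is already `0`, and the second test can only write `0` again.
    simp only [Cmd.run, NExp.eval, ss]
    split_ifs <;> simp [this, eo]

/-! ### The makespan -/

/-- The memory contains the instance, the order of the clients and the table. -/
structure HasTable (I : Inst n) (ℓ r : ℕ → Fin n) (m : Mem ℝ) : Prop
    extends HasOrder I ℓ r m where
  cell : ∀ i j δ, i ≤ I.total .L → j ≤ I.total .R → CellDone I ℓ r m i j δ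

/-- The cells that hold the instance, the order of the clients and the table. -/
def tablePart (m : Mem ℝ) :=
  (sortedPart m, m.warr .DL, m.warr .DR, m.narr .predL, m.narr .predR)

lemma HasTable.congr {m m' : Mem ℝ} (h : HasTable I ℓ r m) (e : tablePart m' = tablePart m) :
    HasTable I ℓ r m' := by
  simp only [tablePart, Prod.mk.injEq] at e
  obtain ⟨e0, e1, e2, e3, e4⟩ := e
  refine ⟨h.toHasOrder.congr e0, fun i j δ hi hj => (h.cell i j δ hi hj).congr ?_ ?_⟩
  · cases δ
    · exact congrFun (congrFun e1 i) j
    · exact congrFun (congrFun e2 i) j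
  · cases δ
    · exact congrFun (congrFun e3 i) j
    · exact congrFun (congrFun e4 i) j

lemma HasTable.cell_counts {m : Mem ℝ} (h : HasTable I ℓ r m) {c : Side → ℕ}
    (hc : ∀ δ, c δ ≤ I.total δ) (δ : Side) :
    m.warr δ.valArr (c .L) (c .R) = I.tab ℓ r c δ ∧ (c δ ≠ 0 → drop c δ ≠ 0 →
      m.narr δ.predArr (c .L) (c .R) = (I.predSide ℓ r (drop c δ) δ).code) := by
  have := h.cell (c .L) (c .R) δ (hc _) (hc _)
  rwa [CellDone, counts_eta] at this

lemma finishCmd_keeps : finishCmd.Keeps tablePart := by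
  simp [Cmd.Keeps, finishCmd, Cmd.block, tablePart, sortedPart, instPart, Mem.setN, Mem.setW]

lemma HasInst.eval_return {m : Mem ℝ} (h : HasInst I m) {e : NExp} {a : Fin n}
    (ha : e.eval m = a) (δ : Side) {D : WithTop ℝ} (hw : m.wreg .y = D) :
    (WExp.add (.reg .y) (.abs (frontExp δ e (.reg .y)))).eval m = I.returnTime δ a D := by
  cases D with
  | top => simp [WExp.eval, hw, Inst.returnTime]
  | coe y =>
    simp only [WExp.eval, h.eval_frontExp ha δ (w := .reg .y) hw, hw, Inst.returnTime, lift₁_coe,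
      lift₂_coe]

/-- The table is filled even if a first deadline is missed; the flag `ok` then overrides the value
by `⊤`. -/
lemma run_finishCmd {m : Mem ℝ} (h : HasTable I ℓ r m)
    (hok : m.nreg .ok = 0 ↔ ¬ I.FirstInTime ℓ r) :
    HasTable I ℓ r (finishCmd.run m) ∧ (finishCmd.run m).wreg .out = I.dpValue ℓ r ∧
      (finishCmd.run m).nreg .side = (I.finalSide ℓ r).code := by
  refine ⟨h.congr (finishCmd_keeps.run m), ?_⟩
  obtain ⟨m1, hm1⟩ : ∃ m1, m1 = m.setW .y (I.tab ℓ r I.total .L) := ⟨_, rfl⟩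
  obtain ⟨m2, hm2⟩ : ∃ m2, m2 = m1.setW .c₁ (I.final ℓ r .L) := ⟨_, rfl⟩
  obtain ⟨m3, hm3⟩ : ∃ m3, m3 = m2.setW .y (I.tab ℓ r I.total .R) := ⟨_, rfl⟩
  obtain ⟨m4, hm4⟩ : ∃ m4, m4 = m3.setW .c₂ (I.final ℓ r .R) := ⟨_, rfl⟩
  have h1 : HasInst I m1 := hm1 ▸ h.toHasInst.setW (by decide) _
  have h2 : HasInst I m2 := hm2 ▸ h1.setW (by decide) _
  have h3 : HasInst I m3 := hm3 ▸ h2.setW (by decide) _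
  have e1 : WExp.eval m (.get .DL (.reg .nL) (.reg .nR)) = I.tab ℓ r I.total .L := by
    simp only [WExp.eval, NExp.eval, h.nL, h.nR]
    exact (h.cell_counts (fun _ => le_rfl) .L).1
  have e2 : WExp.eval m1 (.add (.reg .y) (.abs (frontExp .L (lftAt (.reg .nL)) (.reg .y)))) =
      I.final ℓ r .L :=
    h1.eval_return (by rw [hm1]; simp [lftAt, NExp.eval, Mem.setW, h.nL, h.lft, Side.ord]) .L
      (by rw [hm1]; simp [Mem.setW])
  have e3 : WExp.eval m2 (.get .DR (.reg .nL) (.reg .nR)) = I.tab ℓ r I.total .R := by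
    rw [hm2, hm1]
    simp only [WExp.eval, NExp.eval, Mem.setW, h.nL, h.nR]
    exact (h.cell_counts (fun _ => le_rfl) .R).1
  have e4 : WExp.eval m3 (.add (.reg .y) (.abs (frontExp .R (rgtAt (.reg .nR)) (.reg .y)))) =
      I.final ℓ r .R :=
    h3.eval_return (by
      rw [hm3, hm2, hm1]; simp [rgtAt, NExp.eval, Mem.setW, h.nR, h.rgt, Side.ord]) .R
      (by rw [hm3]; simp [Mem.setW])
  have c1 : m4.wreg .c₁ = I.final ℓ r .L := by rw [hm4, hm3, hm2]; simp [Mem.setW]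
  have c2 : m4.wreg .c₂ = I.final ℓ r .R := by rw [hm4]; simp [Mem.setW]
  have hk : m4.nreg .ok = m.nreg .ok := by rw [hm4, hm3, hm2, hm1]; rfl
  rw [finishCmd, run_block_cons, run_setW e1, ← hm1, run_block_cons, run_setW e2, ← hm2,
    run_block_cons, run_setW e3, ← hm3, run_block_cons, run_setW e4, ← hm4, run_block_cons,
    run_block_one]
  simp only [Cmd.block, Cmd.run, BExp.eval, WExp.eval, NExp.eval, c1, c2, decide_eq_true_eq]
  by_cases hf : I.FirstInTime ℓ r
  · have h0 : ¬ m.nreg .ok = 0 := fun h' => hok.1 h' hf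
    rw [Inst.dpValue_eq hf, Inst.finalSide]
    by_cases hle : I.final ℓ r .L ≤ I.final ℓ r .R
    · simp [hle, Mem.setN, Mem.setW, hk, h0, Side.code]
    · simp [hle, Mem.setN, Mem.setW, hk, h0, Side.code]
  · have h0 := hok.2 hf
    rw [Inst.dpValue, if_neg hf, Inst.finalSide]
    by_cases hle : I.final ℓ r .L ≤ I.final ℓ r .R
    · simp [hle, Mem.setN, Mem.setW, hk, h0, Side.code]
    · simp [hle, Mem.setN, Mem.setW, hk, h0, Side.code]

/-! ### The rendezvous -/

/-- The array that holds the order of the clients of a side. -/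
def Side.ordArr : Side → NArr
  | .L => .lft
  | .R => .rgt

/-- The register that counts the clients of a side. -/
def Side.reg : Side → NReg
  | .L => .i
  | .R => .j

/-- Store the rendezvous of the current state of side `δ`, and go to the preceding state. -/
def traceBranch (δ : Side) : Cmd :=
  .block [
    .setN .a (.get δ.ordArr (.reg δ.reg) (.lit 0)),
    .setW .y (.get δ.valArr (.reg .i) (.reg .j)),
    .setWArr .t (.reg .a) (.lit 0) (.reg .y),
    .setWArr .x (.reg .a) (.lit 0) (frontExp δ (.reg .a) (.reg .y)),
    .setN .side (.get δ.predArr (.reg .i) (.reg .j)),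
    .setN δ.reg (.sub (.reg δ.reg) (.lit 1))]

/-- The body of the loop that traces the path. -/
def traceBody : Cmd := .ite (.natEq (.reg .side) (.lit 0)) (traceBranch .L) (traceBranch .R)

lemma traceBody_keeps : traceBody.Keeps tablePart := by
  simp [Cmd.Keeps, traceBody, traceBranch, Cmd.block, tablePart, sortedPart, instPart,
    Mem.setN, Mem.setW, Mem.setWArr, Side.reg]

lemma HasInst.setWArr {m : Mem ℝ} (h : HasInst I m) {x : WArr} (hs : x ≠ .s) (hd : x ≠ .d)
    (p q : ℕ) (z : WithTop ℝ) : HasInst I (m.setWArr x p q z) := by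
  refine h.congr ?_
  simp [instPart, Mem.setWArr, hs.symm, hd.symm]

/-- The new value of `side` matters only if a client remains: no preceding side is recorded for an
initial state. -/
lemma run_traceBody {m : Mem ℝ} (h : HasTable I ℓ r m) {c : Side → ℕ} {δ : Side} {y : ℝ}
    (hc : ∀ δ, c δ ≤ I.total δ) (hy : I.tab ℓ r c δ = y)
    (hi : m.nreg .i = c .L) (hj : m.nreg .j = c .R) (hside : m.nreg .side = δ.code) :
    (traceBody.run m).nreg .i = drop c δ .L ∧ (traceBody.run m).nreg .j = drop c δ .R ∧
      (drop c δ ≠ 0 → (traceBody.run m).nreg .side = (I.predSide ℓ r (drop c δ) δ).code) ∧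
      (∀ p, (traceBody.run m).warr .t p 0 =
        if p = δ.ord ℓ r (c δ) then (y : WithTop ℝ) else m.warr .t p 0) ∧
      (∀ p, (traceBody.run m).warr .x p 0 =
        if p = δ.ord ℓ r (c δ) then (I.front δ (δ.ord ℓ r (c δ)) y : WithTop ℝ)
        else m.warr .x p 0) := by
  have hcell := h.cell_counts hc δ
  have hδ := Inst.tab_side_ne_zero hy
  rw [hy] at hcell
  have hreg : m.nreg δ.reg = c δ := by cases δ <;> assumption
  have hord : m.narr δ.ordArr (c δ) 0 = δ.ord ℓ r (c δ) := by
    cases δ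
    · exact h.lft _
    · exact h.rgt _
  obtain ⟨a, ha⟩ : ∃ a, a = δ.ord ℓ r (c δ) := ⟨_, rfl⟩
  rw [← ha] at hord ⊢
  obtain ⟨m1, hm1⟩ : ∃ m1, m1 = m.setN .a a := ⟨_, rfl⟩
  obtain ⟨m2, hm2⟩ : ∃ m2, m2 = m1.setW .y y := ⟨_, rfl⟩
  obtain ⟨m3, hm3⟩ : ∃ m3, m3 = m2.setWArr .t a 0 y := ⟨_, rfl⟩
  obtain ⟨m4, hm4⟩ : ∃ m4, m4 = m3.setWArr .x a 0 (I.front δ a y) := ⟨_, rfl⟩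
  have h3 : HasInst I m3 := by
    rw [hm3, hm2, hm1]
    exact ((h.toHasInst.setN (by decide) _).setW (by decide) _).setWArr (by decide) (by decide) ..
  have ha2 : m2.nreg .a = a := by rw [hm2, hm1]; simp [Mem.setN, Mem.setW]
  have ha3 : m3.nreg .a = a := by rw [hm3]; exact ha2
  have hy2 : m2.wreg .y = y := by rw [hm2]; simp [Mem.setW]
  have hy3 : m3.wreg .y = y := by rw [hm3]; exact hy2
  have n4 : ∀ x, x ≠ .a → m4.nreg x = m.nreg x := fun x hx => by
    rw [hm4, hm3, hm2, hm1]; simp [Mem.setN, Mem.setW, Mem.setWArr, hx]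
  have rn : m4.narr = m.narr := by rw [hm4, hm3, hm2, hm1]; rfl
  have e : traceBody.run m =
      (m4.setN .side (m.narr δ.predArr (c .L) (c .R))).setN δ.reg (c δ - 1) := by
    have e0 : traceBody.run m = (traceBranch δ).run m := by
      rw [traceBody]
      cases δ
      · exact run_ite_pos (by simp [BExp.eval, NExp.eval, hside, Side.code])
      · exact run_ite_neg (by simp [BExp.eval, NExp.eval, hside, Side.code])
    have h5 : ∀ z, NExp.eval (m4.setN .side z) (.sub (.reg δ.reg) (.lit 1)) = c δ - 1 := fun z => by
      rw [← hreg, ← n4 δ.reg (by cases δ <;> decide)]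
      cases δ <;> simp [NExp.eval, Mem.setN, Side.reg]
    rw [e0, traceBranch, run_block_cons, run_setN (z := a) (by simp only [NExp.eval, hreg, hord]),
      ← hm1, run_block_cons, run_setW (z := y) (by
        rw [hm1]; simpa [WExp.eval, NExp.eval, Mem.setN, hi, hj] using hcell.1), ← hm2,
      run_block_cons, run_setWArr (m := m2) (ep := .reg .a) (eq := .lit 0) (q := 0) (e := .reg .y) ha2 rfl hy2, ← hm3,
      run_block_cons, run_setWArr (m := m3) (ep := .reg .a) (eq := .lit 0) (q := 0) ha3 rfl
        (h3.eval_frontExp (e := .reg .a) ha3 δ (w := .reg .y) hy3), ← hm4, run_block_cons,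
      run_setN (z := m.narr δ.predArr (c .L) (c .R)) (by
        simp only [NExp.eval, n4 .i (by decide), n4 .j (by decide), hi, hj, rn]),
      run_block_one, run_setN (h5 _)]
  have rt : ∀ p, m4.warr .t p 0 = if p = a then (y : WithTop ℝ) else m.warr .t p 0 := fun p => by
    rw [hm4, hm3, hm2, hm1]; simp [Mem.setN, Mem.setW, Mem.setWArr]
  have rx : ∀ p, m4.warr .x p 0 = if p = a then (I.front δ a y : WithTop ℝ)
      else m.warr .x p 0 := fun p => by
    rw [hm4, hm3, hm2, hm1]; simp [Mem.setN, Mem.setW, Mem.setWArr]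
  rw [e]
  refine ⟨?_, ?_, fun hd => ?_, rt, rx⟩
  · cases δ <;> simp [Mem.setN, Side.reg, n4, hi, drop]
  · cases δ <;> simp [Mem.setN, Side.reg, n4, hj, drop]
  · rw [hcell.2 hδ hd]
    cases δ <;> simp [Mem.setN, Side.reg]

lemma traceCmd_keeps : traceCmd.Keeps (fun m : Mem ℝ => m.wreg .out) := by
  simp [Cmd.Keeps, traceCmd, Cmd.block, Mem.setN, Mem.setW, Mem.setWArr]

lemma run_traceCmd {m : Mem ℝ} (h : HasTable I ℓ r m) (hord : I.IsOrdering ℓ r)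
    (hout : m.wreg .out ≠ ⊤) {δ₀ : Side} (hside : m.nreg .side = δ₀.code) {y₀ : ℝ}
    (h0 : I.tab ℓ r I.total δ₀ = y₀) :
    ∀ k < n, (traceCmd.run m).warr .t (I.traceClient ℓ r δ₀ k) 0 = I.traceTime ℓ r δ₀ k ∧
      (traceCmd.run m).warr .x (I.traceClient ℓ r δ₀ k) 0 = I.tracePos ℓ r δ₀ k := by
  obtain ⟨m1, hm1⟩ : ∃ m1, m1 = (m.setN .i (I.total .L)).setN .j (I.total .R) := ⟨_, rfl⟩
  have e : traceCmd.run m = iterate traceBody.run .k 0 n m1 := by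
    have e1 : (m.setN .i (I.total .L)).nreg .nR = I.total .R := by simp [Mem.setN, h.nR]
    have e2 : m1.nreg .n = n := by rw [hm1]; simp [Mem.setN, h.size]
    have hlt : m.wreg .out < ⊤ := lt_top_iff_ne_top.2 hout
    simp only [traceCmd, Cmd.block, Cmd.run, BExp.eval, WExp.eval, NExp.eval, hlt, decide_true,
      if_true, h.nL, e1, ← hm1, e2, Nat.sub_zero]
    rfl
  have h1 : HasTable I ℓ r m1 := by
    refine h.congr ?_
    rw [hm1]
    simp [tablePart, sortedPart, instPart, Mem.setN]
  have key := iterate_induction (f := traceBody.run) (x := .k) (lo := 0) (m := m1)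
    (fun k m' => HasTable I ℓ r m' ∧
      -- After the last iteration there is no current state, hence the guard.
      (k < n → m'.nreg .i = (I.trace ℓ r δ₀ k).1 .L ∧ m'.nreg .j = (I.trace ℓ r δ₀ k).1 .R ∧
        m'.nreg .side = (I.trace ℓ r δ₀ k).2.code) ∧
      ∀ k' < k, m'.warr .t (I.traceClient ℓ r δ₀ k') 0 = I.traceTime ℓ r δ₀ k' ∧
        m'.warr .x (I.traceClient ℓ r δ₀ k') 0 = I.tracePos ℓ r δ₀ k')
    ⟨h1, fun _ => by rw [hm1]; simp [Mem.setN, Inst.trace, hside],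
      fun k' hk' => absurd hk' (Nat.not_lt_zero _)⟩ n
    (by
      rintro k hk m2 ⟨ht, hreg, hdone⟩
      obtain ⟨hi, hj, hs⟩ := hreg hk
      have ht' : HasTable I ℓ r (m2.setN .k (0 + k)) :=
        ht.congr (by simp [tablePart, sortedPart, instPart, Mem.setN])
      obtain ⟨g1, g2, g3, g4, g5⟩ := run_traceBody ht' (Inst.trace_le k) (Inst.tab_trace h0 hk)
        (by simpa [Mem.setN] using hi) (by simpa [Mem.setN] using hj)
        (by simpa [Mem.setN] using hs)
      have hk1 := traceBody_keeps.run (m2.setN .k (0 + k))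
      refine ⟨ht'.congr hk1, fun hk2 => ⟨g1, g2, g3 ?_⟩, fun k' hk' => ?_⟩
      · have hsum := (Inst.trace_finite h0 k hk).2
        have := drop_add (Inst.trace_side_ne_zero h0 hk)
        rw [Ne, counts_eq_zero_iff]
        omega
      · rcases Nat.lt_succ_iff_lt_or_eq.1 hk' with hlt | rfl
        -- The traced clients are distinct, so earlier entries are not overwritten.
        · have hne : (I.traceClient ℓ r δ₀ k' : ℕ) ≠ I.traceClient ℓ r δ₀ k :=
            fun h' => Inst.traceClient_ne hord h0 hlt hk (Fin.ext h')
          exact ⟨(g4 _).trans ((if_neg hne).trans (hdone k' hlt).1),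
            (g5 _).trans ((if_neg hne).trans (hdone k' hlt).2)⟩
        · exact ⟨(g4 _).trans (if_pos rfl), (g5 _).trans (if_pos rfl)⟩)
  rw [e]
  exact key.2.2

end CLTSP

namespace CLTSP

open RealRAM

variable {n : ℕ} {I : Inst n}

/-! ### Sorting -/

open Classical in
/-- The number of indices below `k` with a given property. -/
noncomputable def countBelow (P : Fin n → Prop) (k : ℕ) : ℕ :=
  (Finset.univ.filter fun b : Fin n => (b : ℕ) < k ∧ P b).card

@[simp] lemma countBelow_zero (P : Fin n → Prop) : countBelow P 0 = 0 := by simp [countBelow]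

open Classical in
lemma countBelow_succ (P : Fin n → Prop) {k : ℕ} (hk : k < n) :
    countBelow P (k + 1) = countBelow P k + if P ⟨k, hk⟩ then 1 else 0 := by
  unfold countBelow
  split_ifs with hP
  · rw [← Finset.card_insert_of_notMem (a := (⟨k, hk⟩ : Fin n)) (by simp)]
    congr 1
    ext b
    simp only [Finset.mem_filter, Finset.mem_univ, true_and, Finset.mem_insert, Fin.ext_iff]
    constructor
    · rintro ⟨h1, h2⟩
      by_cases hb : (b : ℕ) = k
      · exact Or.inl hb
      · exact Or.inr ⟨by omega, h2⟩
    · rintro (hb | ⟨h1, h2⟩)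
      · have : b = ⟨k, hk⟩ := Fin.ext hb
        exact ⟨by omega, this ▸ hP⟩
      · exact ⟨by omega, h2⟩
  · rw [add_zero]
    congr 1
    ext b
    simp only [Finset.mem_filter, Finset.mem_univ, true_and, and_congr_left_iff]
    intro hb
    have : (b : ℕ) ≠ k := fun h => hP (by rwa [← (Fin.ext h : b = ⟨k, hk⟩)])
    omega

open Classical in
lemma countBelow_size (P : Fin n → Prop) : countBelow P n = (Finset.univ.filter P).card := by
  simp [countBelow]

/-- Client `b` precedes client `a` in the order by distance, with ties broken by the index. -/
def Prec (I : Inst n) (b a : Fin n) : Prop :=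
  |I.s b| < |I.s a| ∨ (|I.s b| ≤ |I.s a| ∧ b < a)

lemma Prec.trans {a b c : Fin n} (h : Prec I a b) (h' : Prec I b c) : Prec I a c := by
  unfold Prec at *
  rcases h with h | ⟨h1, h2⟩ <;> rcases h' with h' | ⟨h1', h2'⟩
  · exact Or.inl (h.trans h')
  · exact Or.inl (h.trans_le h1')
  · exact Or.inl (h1.trans_lt h')
  · exact Or.inr ⟨h1.trans h1', h2.trans h2'⟩

lemma Prec.irrefl (a : Fin n) : ¬ Prec I a a := by simp [Prec]

lemma Prec.total {a b : Fin n} (h : a ≠ b) : Prec I a b ∨ Prec I b a := by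
  unfold Prec
  rcases lt_trichotomy |I.s a| |I.s b| with h1 | h1 | h1
  · exact Or.inl (Or.inl h1)
  · rcases lt_or_gt_of_ne h with h2 | h2
    · exact Or.inl (Or.inr ⟨h1.le, h2⟩)
    · exact Or.inr (Or.inr ⟨h1.ge, h2⟩)
  · exact Or.inr (Or.inl h1)

/-- The position of a client in the order of its side. -/
noncomputable def rank (I : Inst n) (δ : Side) (a : Fin n) : ℕ :=
  1 + countBelow (fun b => b ∈ I.clients δ ∧ Prec I b a) n

/-- Whatever precedes `b` precedes `a`, and `b` itself is counted only for `a`. -/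
lemma rank_lt {δ : Side} {a b : Fin n} (hb : b ∈ I.clients δ) (h : Prec I b a) :
    rank I δ b < rank I δ a := by
  classical
  rw [rank, rank, countBelow_size, countBelow_size]
  refine Nat.add_lt_add_left (Finset.card_lt_card ?_) 1
  rw [Finset.ssubset_iff_of_subset]
  · exact ⟨b, by simp [hb, h], by simp [Prec.irrefl]⟩
  · intro c
    simp only [Finset.mem_filter, Finset.mem_univ, true_and]
    exact fun hc => ⟨hc.1, hc.2.trans h⟩

lemma rank_injOn (δ : Side) : Set.InjOn (rank I δ) (I.clients δ) := by
  intro a ha b hb he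
  by_contra hne
  rcases Prec.total (I := I) hne with h | h
  · exact absurd he (rank_lt ha h).ne
  · exact absurd he (rank_lt hb h).ne'

lemma rank_mem {δ : Side} {a : Fin n} (ha : a ∈ I.clients δ) :
    rank I δ a ∈ Finset.Icc 1 (I.clients δ).card := by
  classical
  rw [Finset.mem_Icc, rank, countBelow_size]
  refine ⟨by omega, ?_⟩
  rw [add_comm]
  refine Finset.card_lt_card ?_
  rw [Finset.ssubset_iff_of_subset]
  · exact ⟨a, ha, by simp [Prec.irrefl]⟩
  · intro c
    simp only [Finset.mem_filter, Finset.mem_univ, true_and]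
    exact fun hc => hc.1

/-- Pigeonhole: the ranks are distinct and lie in an interval with as many elements as there are
clients of the side. -/
lemma exists_rank_eq {δ : Side} {k : ℕ} (h1 : 1 ≤ k) (h2 : k ≤ (I.clients δ).card) :
    ∃ a ∈ I.clients δ, rank I δ a = k := by
  classical
  have hsub : (I.clients δ).image (rank I δ) ⊆ Finset.Icc 1 (I.clients δ).card :=
    Finset.image_subset_iff.2 fun a ha => rank_mem ha
  have heq := Finset.eq_of_subset_of_card_le hsub (by
    rw [Finset.card_image_of_injOn (rank_injOn δ), Nat.card_Icc, Nat.add_sub_cancel])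
  have : k ∈ (I.clients δ).image (rank I δ) := by
    rw [heq, Finset.mem_Icc]
    exact ⟨h1, h2⟩
  exact Finset.mem_image.1 this

/-- An enumeration inverse to `rank` is a bijection because every index is a rank, and it is
monotone because a strictly closer client has a strictly smaller rank. -/
lemma isOrdering_of_rank {ℓ r : ℕ → Fin n}
    (h : ∀ δ, ∀ a ∈ I.clients δ, Side.ord ℓ r δ (rank I δ a) = a) : I.IsOrdering ℓ r := by
  have bij : ∀ δ, Set.BijOn (Side.ord ℓ r δ) (Set.Icc 1 (I.clients δ).card) (I.clients δ) := by
    refine fun δ => ⟨?_, ?_, ?_⟩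
    · rintro k ⟨h1, h2⟩
      obtain ⟨a, ha, rfl⟩ := exists_rank_eq h1 h2
      rw [h δ a ha]
      exact ha
    · rintro k ⟨h1, h2⟩ m ⟨h3, h4⟩ he
      obtain ⟨a, ha, rfl⟩ := exists_rank_eq h1 h2
      obtain ⟨b, hb, rfl⟩ := exists_rank_eq h3 h4
      rw [h δ a ha, h δ b hb] at he
      rw [he]
    · intro a ha
      exact ⟨rank I δ a, Finset.mem_Icc.1 (rank_mem ha), h δ a ha⟩
  have mono : ∀ δ i j, 1 ≤ i → i ≤ j → j ≤ (I.clients δ).card →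
      |I.s (Side.ord ℓ r δ i)| ≤ |I.s (Side.ord ℓ r δ j)| := by
    intro δ i j h1 h2 h3
    obtain ⟨a, ha, rfl⟩ := exists_rank_eq h1 (h2.trans h3)
    obtain ⟨b, hb, rfl⟩ := exists_rank_eq (h1.trans h2) h3
    rw [h δ a ha, h δ b hb]
    by_contra hlt
    exact absurd (rank_lt hb (Or.inl (not_le.1 hlt))) (not_lt.2 h2)
  exact ⟨bij .L, bij .R, mono .L, mono .R⟩

/-- The register that holds the number of clients of a side. -/
def Side.sizeReg : Side → NReg
  | .L => .nL
  | .R => .nR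

/-- The test for the side of a client. -/
def sideTest : Side → NExp → BExp
  | .L, a => isLeft a
  | .R, a => .not (isLeft a)

/-- The body of the loop that computes the rank of a client of side `δ`. -/
def rankBody (δ : Side) : Cmd :=
  .ite (.and (sideTest δ (.reg .b)) precedes) (.setN .k (.add (.reg .k) (.lit 1))) .skip

/-- Store a client of side `δ` according to its rank. -/
def placeCmd (δ : Side) : Cmd :=
  .block [
    .forLoop .b (.lit 0) (.reg .n) (rankBody δ),
    .setNArr δ.ordArr (.reg .k) (.lit 0) (.reg .a),
    .setN δ.sizeReg (.add (.reg δ.sizeReg) (.lit 1))]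

/-- The body of the outer loop of the sorting procedure. -/
def sortBody : Cmd :=
  .block [.setN .k (.lit 1), .ite (isLeft (.reg .a)) (placeCmd .L) (placeCmd .R)]

lemma sortCmd_eq : sortCmd =
    .block [.setN .nL (.lit 0), .setN .nR (.lit 0), .forLoop .a (.lit 0) (.reg .n) sortBody] := rfl

lemma HasInst.eval_isLeft {m : Mem ℝ} (h : HasInst I m) {e : NExp} {a : Fin n}
    (ha : e.eval m = a) : (isLeft e).eval m = true ↔ a ∈ I.clients .L := by
  simp only [isLeft, BExp.eval, h.eval_sOf ha, WExp.eval, decide_eq_true_eq, WithTop.coe_le_coe,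
    Inst.mem_clients]

lemma HasInst.eval_sideTest {m : Mem ℝ} (h : HasInst I m) {e : NExp} {a : Fin n}
    (ha : e.eval m = a) (δ : Side) : (sideTest δ e).eval m = true ↔ a ∈ I.clients δ := by
  cases δ
  · exact h.eval_isLeft ha
  · rw [sideTest, BExp.eval, Bool.not_eq_true', ← Bool.not_eq_true, h.eval_isLeft ha,
      Inst.mem_clients, Inst.mem_clients, not_le]

lemma HasInst.eval_precedes {m : Mem ℝ} (h : HasInst I m) {a b : Fin n} (ha : m.nreg .a = a)
    (hb : m.nreg .b = b) : precedes.eval m = true ↔ Prec I b a := by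
  have ea := h.eval_sOf (e := .reg .a) ha
  have eb := h.eval_sOf (e := .reg .b) hb
  simp only [precedes, BExp.eval, WExp.eval, ea, eb, NExp.eval, ha, hb, lift₁_coe, Bool.or_eq_true,
    Bool.and_eq_true, decide_eq_true_eq, WithTop.coe_lt_coe, WithTop.coe_le_coe, Prec, Fin.lt_def]

/-- The part of the memory that the computation of a rank does not change. -/
def rankFrame (m : Mem ℝ) := (instPart m, m.narr, m.nreg .a, m.nreg .nL, m.nreg .nR)

lemma rankBody_keeps (δ : Side) : (rankBody δ).Keeps rankFrame := by
  simp [Cmd.Keeps, rankBody, rankFrame, instPart, Mem.setN]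

lemma run_rankLoop {m : Mem ℝ} (h : HasInst I m) {a : Fin n} (ha : m.nreg .a = a)
    (hk : m.nreg .k = 1) (δ : Side) {m' : Mem ℝ}
    (hm' : m' = (Cmd.forLoop .b (.lit 0) (.reg .n) (rankBody δ)).run m) :
    rankFrame m' = rankFrame m ∧ m'.nreg .k = rank I δ a := by
  classical
  have hf : (Cmd.forLoop .b (.lit 0) (.reg .n) (rankBody δ)).Keeps rankFrame :=
    ⟨by simp [rankFrame, instPart, Mem.setN], rankBody_keeps δ⟩
  refine ⟨hm' ▸ hf.run m, ?_⟩
  rw [hm', Cmd.run]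
  simp only [NExp.eval, h.size, Nat.sub_zero]
  refine (iterate_induction (fun k m' => rankFrame m' = rankFrame m ∧
    m'.nreg .k = 1 + countBelow (fun b => b ∈ I.clients δ ∧ Prec I b a) k) ⟨rfl, by simp [hk]⟩ n
    fun k hkn m1 hm1 => ?_).2
  obtain ⟨hfr, hc⟩ := hm1
  have hfr' : rankFrame (m1.setN .b (0 + k)) = rankFrame m := hf.1 m1 _ |>.trans hfr
  refine ⟨((rankBody_keeps δ).run _).trans hfr', ?_⟩
  have hi : HasInst I (m1.setN .b (0 + k)) := h.congr (Prod.mk.inj hfr').1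
  have ha' : (m1.setN .b (0 + k)).nreg .a = a := by
    simp only [rankFrame, Prod.mk.injEq] at hfr'
    exact hfr'.2.2.1.trans ha
  have hb' : (m1.setN .b (0 + k)).nreg .b = (⟨k, hkn⟩ : Fin n) := by simp [Mem.setN]
  have htest : (BExp.and (sideTest δ (.reg .b)) precedes).eval (m1.setN .b (0 + k)) = true ↔
      (⟨k, hkn⟩ : Fin n) ∈ I.clients δ ∧ Prec I ⟨k, hkn⟩ a := by
    rw [BExp.eval, Bool.and_eq_true, hi.eval_sideTest (e := .reg .b) hb', hi.eval_precedes ha' hb']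
  have hck : (m1.setN .b (0 + k)).nreg .k = m1.nreg .k := by simp [Mem.setN]
  rw [countBelow_succ _ hkn, rankBody, Cmd.run]
  by_cases hP : (⟨k, hkn⟩ : Fin n) ∈ I.clients δ ∧ Prec I ⟨k, hkn⟩ a
  · rw [if_pos (htest.2 hP), if_pos hP, run_setN (z := m1.nreg .k + 1) (by
      simp only [NExp.eval, hck])]
    simp [Mem.setN, hc]
    omega
  · rw [if_neg (fun h => hP (htest.1 h)), if_neg hP, Cmd.run, hck, hc]
    omega

lemma run_placeCmd {m : Mem ℝ} (h : HasInst I m) {a : Fin n} (ha : m.nreg .a = a)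
    (hk : m.nreg .k = 1) (δ : Side) {m' : Mem ℝ} (hm' : m' = (placeCmd δ).run m) :
    HasInst I m' ∧
      (∀ δ', m'.nreg δ'.sizeReg = if δ' = δ then m.nreg δ'.sizeReg + 1 else m.nreg δ'.sizeReg) ∧
      (∀ δ' i, m'.narr δ'.ordArr i 0 =
        if δ' = δ ∧ i = rank I δ a then (a : ℕ) else m.narr δ'.ordArr i 0) := by
  obtain ⟨m1, hm1⟩ : ∃ m1, m1 = (Cmd.forLoop .b (.lit 0) (.reg .n) (rankBody δ)).run m := ⟨_, rfl⟩
  obtain ⟨hfr, hrank⟩ := run_rankLoop h ha hk δ hm1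
  simp only [rankFrame, Prod.mk.injEq] at hfr
  obtain ⟨f1, f2, f3, f4, f5⟩ := hfr
  have hs : ∀ δ' : Side, m1.nreg δ'.sizeReg = m.nreg δ'.sizeReg := by
    intro δ'; cases δ' <;> assumption
  have e : m' = (m1.setNArr δ.ordArr (rank I δ a) 0 a).setN δ.sizeReg
      (m.nreg δ.sizeReg + 1) := by
    rw [hm', placeCmd, run_block_cons, ← hm1, run_block_cons, run_block_one]
    simp only [Cmd.run, NExp.eval, hrank, f3, ha, Mem.setNArr, hs]
  rw [e]
  refine ⟨?_, fun δ' => ?_, fun δ' i => ?_⟩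
  · refine HasInst.setN ?_ (by cases δ <;> decide) _
    exact (h.congr f1).congr rfl
  · cases δ <;> cases δ' <;> simp [Mem.setN, Mem.setNArr, Side.sizeReg, f4, f5]
  · cases δ <;> cases δ' <;> simp [Mem.setN, Mem.setNArr, Side.ordArr, f2]

lemma hasInst_input (I : Inst n) : HasInst I I.input := by
  refine ⟨rfl, rfl, fun a => ?_, fun a => ?_⟩ <;> simp [Inst.input]

lemma run_sortCmd (I : Inst n) (hn : 1 ≤ n) :
    ∃ ℓ r : ℕ → Fin n, I.IsOrdering ℓ r ∧ HasOrder I ℓ r (sortCmd.run I.input) := by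
  classical
  obtain ⟨m0, hm0⟩ : ∃ m0, m0 = (I.input.setN .nL 0).setN .nR 0 := ⟨_, rfl⟩
  have h0 : HasInst I m0 := by
    rw [hm0]
    exact ((hasInst_input I).setN (by decide) _).setN (by decide) _
  have hrun : sortCmd.run I.input = iterate sortBody.run .a 0 n m0 := by
    rw [sortCmd_eq, run_block_cons, run_setN (z := 0) rfl, run_block_cons, run_setN (z := 0) rfl,
      ← hm0, run_block_one, Cmd.run]
    simp only [NExp.eval, h0.size, Nat.sub_zero]
  have key := iterate_induction (f := sortBody.run) (x := .a) (lo := 0) (m := m0)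
    (fun k m => HasInst I m ∧
      (∀ δ : Side, m.nreg δ.sizeReg = countBelow (fun b => b ∈ I.clients δ) k) ∧
      -- Cells outside the range of ranks must also name clients, because `ℓ` and `r` are total
      -- functions and the program reads index `0`. These cells contain `0`, a valid client since `1
      -- ≤ n`.
      (∀ (δ : Side) i, m.narr δ.ordArr i 0 < n) ∧
      ∀ δ : Side, ∀ b : Fin n, (b : ℕ) < k → b ∈ I.clients δ →
        m.narr δ.ordArr (rank I δ b) 0 = b)
    ⟨h0, fun δ => by rw [hm0]; cases δ <;> simp [Mem.setN, Side.sizeReg],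
      fun δ i => by rw [hm0]; exact hn, fun δ b hb => absurd hb (Nat.not_lt_zero _)⟩ n
    (by
      rintro k hk m ⟨h1, h2, h3, h4⟩
      obtain ⟨a, ha⟩ : ∃ a : Fin n, a = ⟨k, hk⟩ := ⟨_, rfl⟩
      have hak : (a : ℕ) = k := by rw [ha]
      obtain ⟨m1, hm1⟩ : ∃ m1, m1 = (m.setN .a (0 + k)).setN .k 1 := ⟨_, rfl⟩
      have i1 : HasInst I m1 := by
        rw [hm1]
        exact (h1.setN (by decide) _).setN (by decide) _
      have a1 : m1.nreg .a = a := by rw [hm1, hak]; simp [Mem.setN]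
      have k1 : m1.nreg .k = 1 := by rw [hm1]; simp [Mem.setN]
      obtain ⟨δ, hδ⟩ := I.exists_mem_clients a
      have hbody : sortBody.run (m.setN .a (0 + k)) = (placeCmd δ).run m1 := by
        rw [sortBody, run_block_cons, run_setN (z := 1) rfl, ← hm1, run_block_one]
        have ht := i1.eval_isLeft (e := .reg .a) a1
        cases δ
        · exact run_ite_pos (ht.2 hδ)
        · exact run_ite_neg fun h' => absurd (Inst.side_unique (ht.1 h') hδ) (by decide)
      obtain ⟨p1, p2, p3⟩ := run_placeCmd i1 a1 k1 δ hbody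
      have s1 : ∀ δ : Side, m1.nreg δ.sizeReg = m.nreg δ.sizeReg := by
        intro δ; rw [hm1]; cases δ <;> simp [Mem.setN, Side.sizeReg]
      have o1 : m1.narr = m.narr := by rw [hm1]; rfl
      refine ⟨p1, fun δ' => ?_, fun δ' i => ?_, fun δ' b hb hbδ => ?_⟩
      · rw [p2, s1, h2, countBelow_succ _ hk, ← ha]
        by_cases hd : δ' = δ
        · rw [if_pos hd, if_pos (hd ▸ hδ)]
        · rw [if_neg hd, if_neg fun h' => hd (Inst.side_unique h' hδ), add_zero]
      · rw [p3, o1]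
        split_ifs
        · exact a.2
        · exact h3 δ' i
      · rw [p3, o1]
        rcases Nat.lt_succ_iff_lt_or_eq.1 hb with hlt | heq
        · rw [if_neg]
          · exact h4 δ' b hlt hbδ
          -- Equal ranks on one side would mean equal clients, so the new entry does not overwrite
          -- an old one.
          · rintro ⟨rfl, he⟩
            have := rank_injOn δ' hbδ hδ he
            rw [this, hak] at hlt
            exact lt_irrefl _ hlt
        · have hba : b = a := Fin.ext (heq.trans hak.symm)
          subst hba
          have hd : δ' = δ := Inst.side_unique hbδ hδ
          rw [if_pos ⟨hd, by rw [hd]⟩])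
  rw [← hrun] at key
  obtain ⟨k1, k2, k3, k4⟩ := key
  refine ⟨fun i => ⟨_, k3 .L i⟩, fun i => ⟨_, k3 .R i⟩, isOrdering_of_rank fun δ a ha => ?_, k1,
    ?_, ?_, fun i => rfl, fun i => rfl⟩
  · have := k4 δ a a.2 ha
    cases δ <;> exact Fin.ext this
  · have := k2 .L
    rw [countBelow_size] at this
    simpa [Inst.total, Side.sizeReg] using this
  · have := k2 .R
    rw [countBelow_size] at this
    simpa [Inst.total, Side.sizeReg] using this

end CLTSP

/-! ## The number of steps -/

namespace RealRAM

/-- The number of steps of a program all of whose loops have at most `N` iterations. -/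
def Cmd.stepBound (N : ℕ) : Cmd → ℕ
  | .skip => 1
  | .setN _ e => e.cost + 1
  | .setNArr _ p q e => p.cost + q.cost + e.cost + 1
  | .setW _ e => e.cost + 1
  | .setWArr _ p q e => p.cost + q.cost + e.cost + 1
  | .seq c c' => c.stepBound N + c'.stepBound N
  | .ite b c c' => b.cost + 1 + (c.stepBound N + c'.stepBound N)
  | .forLoop _ lo hi c => lo.cost + hi.cost + 1 + N * (1 + c.stepBound N)

/-- The nesting depth of the loops of a program. -/
def Cmd.depth : Cmd → ℕ
  | .seq c c' => max c.depth c'.depth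
  | .ite _ c c' => max c.depth c'.depth
  | .forLoop _ _ _ c => c.depth + 1
  | _ => 0

/-- `stepBound` is a polynomial in `N` with natural coefficients and degree at most the nesting
depth. The sum of its coefficients is its value at `1`. -/
lemma Cmd.stepBound_le (N : ℕ) (hN : 1 ≤ N) (c : Cmd) :
    c.stepBound N ≤ c.stepBound 1 * N ^ c.depth := by
  induction c with
  | seq c c' hc hc' =>
    have h1 := Nat.pow_le_pow_right hN (le_max_left c.depth c'.depth)
    have h2 := Nat.pow_le_pow_right hN (le_max_right c.depth c'.depth)
    simp only [stepBound, depth, add_mul]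
    exact Nat.add_le_add (hc.trans (Nat.mul_le_mul_left _ h1))
      (hc'.trans (Nat.mul_le_mul_left _ h2))
  | ite b c c' hc hc' =>
    have h1 := Nat.pow_le_pow_right hN (le_max_left c.depth c'.depth)
    have h2 := Nat.pow_le_pow_right hN (le_max_right c.depth c'.depth)
    have h3 : 1 ≤ N ^ max c.depth c'.depth := Nat.one_le_pow _ _ hN
    simp only [stepBound, depth, add_mul _ _ (N ^ max c.depth c'.depth)]
    exact Nat.add_le_add (by nlinarith) (Nat.add_le_add (hc.trans (Nat.mul_le_mul_left _ h1))
      (hc'.trans (Nat.mul_le_mul_left _ h2)))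
  | forLoop x lo hi c hc =>
    have h3 : 1 ≤ N ^ c.depth := Nat.one_le_pow _ _ hN
    have h4 : 1 ≤ N ^ (c.depth + 1) := Nat.one_le_pow _ _ hN
    simp only [stepBound, depth, one_mul]
    rw [add_mul]
    refine Nat.add_le_add (Nat.le_mul_of_pos_right _ h4) ?_
    rw [pow_succ, mul_comm (N ^ c.depth) N, mul_left_comm]
    refine Nat.mul_le_mul_left _ ?_
    rw [add_mul, one_mul]
    exact Nat.add_le_add h3 hc
  | _ => simp [stepBound, depth]

variable {K : Type}

/-- All loops have at most `N` iterations, as long as the memory has the property `P`. -/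
def Cmd.LoopsLe (P : Mem K → Prop) (N : ℕ) : Cmd → Prop
  | .seq c c' => c.LoopsLe P N ∧ c'.LoopsLe P N
  | .ite _ c c' => c.LoopsLe P N ∧ c'.LoopsLe P N
  | .forLoop _ _ hi c => (∀ m, P m → hi.eval m ≤ N) ∧ c.LoopsLe P N
  | _ => True

lemma iterateSteps_le {f : Mem K → Mem K} {g : Mem K → ℕ} {x : NReg} {lo B : ℕ}
    {P : Mem K → Prop} (hf : ∀ m, P m → P (f m)) (hx : ∀ m z, P m → P (m.setN x z))
    (hg : ∀ m, P m → g m ≤ B) {m : Mem K} (hm : P m) (k : ℕ) :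
    iterateSteps f g x lo k m ≤ k * (1 + B) := by
  induction k with
  | zero => simp [iterateSteps]
  | succ k ih =>
    have hP : P (iterate f x lo k m) :=
      iterate_induction (fun _ m' => P m') hm k fun _ _ m' h' => hf _ (hx _ _ h')
    have := hg _ (hx _ (lo + k) hP)
    simp only [iterateSteps]
    rw [Nat.succ_mul]
    omega

variable [Field K] [LinearOrder K]

/-- Loop bounds are computed from a part of the memory that the program keeps, so the bound `N`
remains valid throughout the execution. -/
lemma Cmd.steps_le {α : Type} {π : Mem K → α} {v : α} {N : ℕ} {c : Cmd} (h : c.Keeps π)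
    (hl : c.LoopsLe (fun m => π m = v) N) (m : Mem K) (hm : π m = v) :
    c.steps m ≤ c.stepBound N := by
  induction c generalizing m with
  | seq c c' hc hc' =>
    exact Nat.add_le_add (hc h.1 hl.1 m hm) (hc' h.2 hl.2 _ ((h.1.run m).trans hm))
  | ite b c c' hc hc' =>
    have h1 := hc h.1 hl.1 m hm
    have h2 := hc' h.2 hl.2 m hm
    simp only [steps, stepBound]
    split_ifs <;> omega
  | forLoop x lo hi c hc =>
    have h1 := iterateSteps_le (f := c.run) (g := c.steps) (x := x) (lo := lo.eval m)
      (B := c.stepBound N) (P := fun m => π m = v) (fun m' h' => (h.2.run m').trans h')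
      (fun m' z h' => (h.1 m' z).trans h') (fun m' h' => hc h.2 hl.2 m' h') hm
      (hi.eval m - lo.eval m)
    have h2 : hi.eval m - lo.eval m ≤ N := (Nat.sub_le _ _).trans (hl.1 m hm)
    exact Nat.add_le_add_left (h1.trans (Nat.mul_le_mul_right _ h2)) _
  | _ => exact le_rfl

end RealRAM

namespace CLTSP

open RealRAM

variable {n : ℕ} {I : Inst n}

/-- The numbers of clients. -/
def sizes (m : Mem ℝ) := (m.nreg .n, m.nreg .nL, m.nreg .nR)

lemma sortCmd_keeps : sortCmd.Keeps (fun m : Mem ℝ => m.nreg .n) := by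
  simp [Cmd.Keeps, sortCmd, Cmd.block, Mem.setN, Mem.setNArr]

lemma restCmd_keeps :
    (Cmd.block [checkCmd, tableCmd, finishCmd, traceCmd]).Keeps sizes := by
  simp [Cmd.Keeps, checkCmd, tableCmd, cellLCmd, cellRCmd, relaxCmd, finishCmd, traceCmd,
    Cmd.block, sizes, Mem.setN, Mem.setNArr, Mem.setW, Mem.setWArr]

/-- Sorting changes the registers `nL` and `nR` that bound later loops, so it is counted separately
with only `n` fixed; the rest keeps all three sizes. The loops of the table include index `0`, hence
the length bound `n + 1`. -/
lemma steps_dpProgram_le (I : Inst n) (hn : 1 ≤ n) :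
    dpProgram.steps I.input ≤ 4 * dpProgram.stepBound 1 * n ^ 2 := by
  obtain ⟨ℓ, r, -, h⟩ := run_sortCmd I hn
  have h1 : sortCmd.steps I.input ≤ sortCmd.stepBound (n + 1) := by
    refine Cmd.steps_le (v := n) sortCmd_keeps ?_ _ rfl
    simp +contextual [Cmd.LoopsLe, sortCmd, Cmd.block, NExp.eval]
  have h2 : (Cmd.block [checkCmd, tableCmd, finishCmd, traceCmd]).steps (sortCmd.run I.input) ≤
      (Cmd.block [checkCmd, tableCmd, finishCmd, traceCmd]).stepBound (n + 1) := by
    have hc := I.card_clients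
    refine Cmd.steps_le (v := (n, I.total .L, I.total .R)) restCmd_keeps ?_ _ ?_
    · have hL : I.total .L ≤ n := by simp only [Inst.total]; omega
      have hR : I.total .R ≤ n := by simp only [Inst.total]; omega
      simp +contextual [Cmd.LoopsLe, checkCmd, tableCmd, cellLCmd, cellRCmd, relaxCmd, finishCmd,
        traceCmd, Cmd.block, sizes, NExp.eval, hL, hR]
    · rw [sizes, h.size, h.nL, h.nR]
  have hd : dpProgram.depth = 2 := rfl
  have h3 := dpProgram.stepBound_le (n + 1) (by omega)
  rw [hd] at h3
  have h4 : (n + 1) ^ 2 ≤ 4 * n ^ 2 := by nlinarith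
  calc dpProgram.steps I.input ≤ dpProgram.stepBound (n + 1) := Nat.add_le_add h1 h2
    _ ≤ dpProgram.stepBound 1 * (4 * n ^ 2) := h3.trans (Nat.mul_le_mul_left _ h4)
    _ = 4 * dpProgram.stepBound 1 * n ^ 2 := by ring

end CLTSP

namespace CLTSP

open RealRAM

variable {n : ℕ}

/-! ## The result of the program -/

lemma run_dpProgram_eq (m : Mem ℝ) : dpProgram.run m =
    traceCmd.run (finishCmd.run (tableCmd.run (checkCmd.run (sortCmd.run m)))) := by
  rw [dpProgram, run_block_cons, run_block_cons, run_block_cons, run_block_cons, run_block_one]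

lemma run_dpProgram (I : Inst n) (hn : 1 ≤ n) {m : Mem ℝ} (hm : m = dpProgram.run I.input) :
    ∃ ℓ r : ℕ → Fin n, I.IsOrdering ℓ r ∧ m.wreg .out = I.dpValue ℓ r ∧
      ∀ y₀ : ℝ, I.dpValue ℓ r ≠ ⊤ → I.tab ℓ r I.total (I.finalSide ℓ r) = y₀ → ∀ k < n,
        m.warr .t (I.traceClient ℓ r (I.finalSide ℓ r) k) 0 =
            I.traceTime ℓ r (I.finalSide ℓ r) k ∧
          m.warr .x (I.traceClient ℓ r (I.finalSide ℓ r) k) 0 =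
            I.tracePos ℓ r (I.finalSide ℓ r) k := by
  obtain ⟨ℓ, r, hord, h1⟩ := run_sortCmd I hn
  rw [run_dpProgram_eq] at hm
  generalize sortCmd.run I.input = m1 at *
  obtain ⟨h2, hok⟩ := run_checkCmd h1
  generalize checkCmd.run m1 = m2 at *
  obtain ⟨h3, hok', hcell⟩ := run_tableCmd h2
  generalize tableCmd.run m2 = m3 at *
  obtain ⟨h4, hout, hside⟩ := run_finishCmd ⟨h3, hcell⟩ (by rw [hok']; exact hok)
  generalize finishCmd.run m3 = m4 at *
  subst hm
  refine ⟨ℓ, r, hord, (traceCmd_keeps.run m4).trans hout, fun y₀ hfin hy₀ => ?_⟩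
  exact run_traceCmd h4 hord (by rwa [hout]) hside hy₀

lemma returns_dpProgram (I : Inst n) (hn : 1 ≤ n) (hτ : I.ZeroProcessing)
    (hr : I.DeadlinesOnly) (hv : I.SlowClients) (hfeas : ∃ S, I.Feasible S) {m : Mem ℝ}
    (hm : m = dpProgram.run I.input) : ∃ S, I.Optimal S ∧ Returns m S := by
  obtain ⟨ℓ, r, h, hout, hrdv⟩ := run_dpProgram I hn hm
  have hfin := Inst.dpValue_ne_top hn hτ hr hv h hfeas
  obtain ⟨y₀, hy₀, S, hS, hval, htr⟩ := Inst.exists_optimal_of_trace hn hτ hr hv h hfin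
  refine ⟨S, hS, hout.trans hval, fun a => ?_⟩
  obtain ⟨k, rfl⟩ := (Inst.traceClient_bijective h hy₀).surjective a
  have h1 := hrdv y₀ hfin hy₀ k k.2
  have h2 := htr k k.2
  exact ⟨h1.1.trans (congrArg _ h2.1.symm), h1.2.trans (congrArg _ h2.2.symm)⟩

end CLTSP

theorem mainTheorem2 :
    ∃ C : ℕ, ∀ (n : ℕ) (I : CLTSP.Inst n), 1 ≤ n →
      I.ZeroProcessing → I.DeadlinesOnly → I.SlowClients →
      -- the equations of the dynamic program give the minimum makespan, or report infeasibility
      (∀ ℓ r : ℕ → Fin n, I.IsOrdering ℓ r →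
        ((¬ ∃ S, I.Feasible S) → I.dpValue ℓ r = ⊤) ∧
        ((∃ S, I.Feasible S) →
          ∃ S, I.Optimal S ∧ I.dpValue ℓ r = (S.makespan : WithTop ℝ))) ∧
      -- the program evaluates these equations
      (∀ ℓ r : ℕ → Fin n, I.IsOrdering ℓ r →
        (CLTSP.dpProgram.run I.input).wreg .out = I.dpValue ℓ r) ∧
      -- it returns an optimal solution, or reports infeasibility
      ((¬ ∃ S, I.Feasible S) → (CLTSP.dpProgram.run I.input).wreg .out = ⊤) ∧
      ((∃ S, I.Feasible S) →
        ∃ S, I.Optimal S ∧ CLTSP.Returns (CLTSP.dpProgram.run I.input) S) ∧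
      -- it takes a quadratic number of steps
      CLTSP.dpProgram.steps I.input ≤ C * n ^ 2 := by
  refine ⟨4 * CLTSP.dpProgram.stepBound 1, fun n I hn hτ hr hv => ?_⟩
  obtain ⟨ℓ₀, r₀, h₀, hout, -⟩ := CLTSP.run_dpProgram I hn rfl
  refine ⟨fun ℓ r h => ⟨CLTSP.Inst.dpValue_eq_top hn hτ hr hv h, fun hfeas => ?_⟩,
    -- The program computes the value for its own ordering, with ties broken by index. Any other
    -- ordering gives the same value, as both equal the minimum makespan or `⊤`.
    fun ℓ r h => hout.trans (CLTSP.Inst.dpValue_congr hn hτ hr hv h₀ h),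
    fun hinf => hout.trans (CLTSP.Inst.dpValue_eq_top hn hτ hr hv h₀ hinf),
    fun hfeas => CLTSP.returns_dpProgram I hn hτ hr hv hfeas rfl,
    CLTSP.steps_dpProgram_le I hn⟩
  obtain ⟨-, -, S, hS, hval, -⟩ := CLTSP.Inst.exists_optimal_of_trace hn hτ hr hv h
    (CLTSP.Inst.dpValue_ne_top hn hτ hr hv h hfeas)
  exact ⟨S, hS, hval⟩
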